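/- Let $k$ be an algebraically closed field and let $Y=\operatorname{Spec} A$ be a connected affine curve over $k$ with normalization $\bigsqcup_{i=1}^s\mathbb A^1$ ($s\ge 1$), so that $A\subset\tilde A=\prod_{i=1}^s k[x_i]$. Assume that there is a closed point $0\in Y$ such that $Y\setminus\{0\}$ is nonsingular and the points of $\bigsqcup_{i=1}^s\mathbb A^1$ lying over $0$ are exactly the $s$ origins $x_i=0$. For positive integers $w=(w_1,\dots,w_s)$ let $F_w^n\subset A$ ($n\in\mathbb Z$) be the set of all $f=(f_1,\dots,f_s)\in A$ with $w_i\operatorname{ord}_{x_i=0}(f_i)\ge n$ for all $i$; this is a filtration of $A$ with $F_w^n=A$ for $n\le 0$. Let $\mathcal R_w=\sum_{n\in\mathbb Z}F_w^n t^{-n}\subset A[t,t^{-1}]$ be its extended Rees algebra, a $k[t]$-algebra. Then there are positive integers $w_1,\dots,w_s$ such that the family $\pi:\mathscr Y=\operatorname{Spec}\mathcal R_w\to\mathbb A^1=\operatorname{Spec}k[t]$ has the following properties. 1. $\pi$ is flat and of finite presentation, and for every $b\in k$ the fibre $\mathscr Y_b$ is a connected affine curve over $k$ (reduced, of finite type,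 of pure dimension $1$). 2. There is a section $\sigma:\mathbb A^1\to\mathscr Y$ of $\pi$, with closed image, such that $\mathscr Y\setminus\sigma(\mathbb A^1)\to\mathbb A^1$ is smooth, and the number of branches and the $\delta$-invariant of the singularity $(\mathscr Y_b,\sigma(b))$ are the same for all $b\in k$; the number of branches is $s$. Here a singularity with completed local ring $R$ has $r$ branches and $\delta$-invariant $\delta$ if the normalization of $R$ is isomorphic to $\prod_{i=1}^r k[[x_i]]$ and $\dim_k\bigl(\prod_{i=1}^r k[[x_i]]/R\bigr)=\delta<\infty$. 3. For every $b\in k$ with $b\neq 0$ there is an isomorphism of $k$-schemes $\mathscr Y_b\cong Y$. 4. $\mathscr Y_0\cong\operatorname{Spec}A_0$ as $k$-schemes, where $A_0\subset\tilde A=\prod_{i=1}^s k[x_i]$ is a monomial subring, that is, a $k$-subalgebra generated by monomials $x_i^n$ with $n\ge1$, and $\tilde A$ is the normalization of $A_0$. -/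

import Mathlib

open AlgebraicGeometry CategoryTheory CategoryTheory.Limits
open scoped Polynomial PowerSeries LaurentPolynomial

noncomputable section

namespace MonomialDegeneration

universe u

/-- An injective integral ring homomorphism `φ : R → S` such that every element of `S` is a fraction
`φ c / φ a` whose denominator is a non-zero-divisor. When `S` is a finite product of normal domains,
as in all uses below (`∏ k[x_i]` and `∏ k⟦x_i⟧`), this says that `S` is the normalization of `R`,
i.e. the integral closure of `R` in its total ring of fractions. -/
def IsNormalizationMap {R S : Type*} [CommRing R] [CommRing S] (φ : R →+* S) : Prop :=
  Function.Injective φ ∧ φ.IsIntegral ∧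
    ∀ f : S, ∃ a c : R, φ a ∈ nonZeroDivisors S ∧ φ a * f = φ c

section Curve

variable {k : Type u} [Field k] {s : ℕ}

/-- For `A ⊆ ∏ k[x_i]`, the ideal of functions in `A` that vanish at the image of the point
`x_i = a` of the `i`-th affine line under `⨆ 𝔸¹ → Spec A`. -/
def pointIdeal (A : Subalgebra k (Fin s → k[X])) (i : Fin s) (a : k) : Ideal A :=
  RingHom.ker ((Polynomial.evalRingHom a).comp
    ((Pi.evalRingHom (fun _ : Fin s => k[X]) i).comp A.val.toRingHom))

/-- `Y = Spec A` is a curve with normalization `⨆_{i=1}^s 𝔸¹`, whose only possibly singular point is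
the closed point `𝔪`, and the points of the normalization lying over `𝔪` are exactly the `s` origins
(so that `(Y, 𝔪)` has `s` branches, with parameters `x_1, …, x_s`). -/
structure IsRationalCurve (A : Subalgebra k (Fin s → k[X])) (𝔪 : Ideal A) : Prop where
  isMaximal : 𝔪.IsMaximal
  isNormalization : IsNormalizationMap A.val.toRingHom
  pointIdeal_eq_iff : ∀ (i : Fin s) (a : k), pointIdeal A i a = 𝔪 ↔ a = 0
  regular : ∀ (p : Ideal A) [p.IsPrime], p ≠ 𝔪 → IsRegularLocalRing (Localization.AtPrime p)

/-- A monomial subring of `∏ k[x_i]`: a `k`-subalgebra generated by monomials `x_i ^ n`, `n ≥ 1`. -/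
def IsMonomialSubring (A₀ : Subalgebra k (Fin s → k[X])) : Prop :=
  ∃ M : Set (Fin s × ℕ), (∀ x ∈ M, 0 < x.2) ∧
    A₀ = Algebra.adjoin k ((fun x : Fin s × ℕ => Pi.single x.1 (Polynomial.X ^ x.2)) '' M)

end Curve

section Rees

/-- A decreasing multiplicative filtration `F^•` of a `k`-algebra `B`, indexed by `ℤ` with
`F^n = B` for `n ≤ 0`. -/
structure RingFiltration (k B : Type*) [Field k] [CommRing B] [Algebra k B] where
  /-- The `n`-th step of the filtration. -/
  step : ℤ → Submodule k B
  antitone : Antitone step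
  step_nonpos : ∀ n ≤ 0, step n = ⊤
  mul_mem : ∀ {m n : ℤ} {f g : B}, f ∈ step m → g ∈ step n → f * g ∈ step (m + n)

variable {k B : Type*} [Field k] [CommRing B] [Algebra k B]

/-- The extended Rees algebra `∑_n F^n t^{-n} ⊆ B[t, t⁻¹]` of a filtered ring. -/
def reesAlgebra (F : RingFiltration k B) : Subalgebra k B[T;T⁻¹] where
  carrier := {p | ∀ n : ℤ, p.coeff (-n) ∈ F.step n}
  mul_mem' := by
    intro p q hp hq n
    classical
    rw [AddMonoidAlgebra.coeff_mul]
    refine Submodule.sum_mem _ fun a _ => Submodule.sum_mem _ fun b _ => ?_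
    dsimp only
    split_ifs with h
    · have h1 := hp (-a)
      have h2 := hq (-b)
      rw [neg_neg] at h1 h2
      have h4 : n = -a + -b := by omega
      rw [h4]
      exact F.mul_mem h1 h2
    · exact Submodule.zero_mem _
  add_mem' := by
    intro p q hp hq n
    exact Submodule.add_mem _ (hp n) (hq n)
  algebraMap_mem' := by
    intro c n
    by_cases hn : n = 0
    · rw [F.step_nonpos n hn.le]
      exact Submodule.mem_top
    · have : (algebraMap k B[T;T⁻¹] c).coeff (-n) = 0 := by
        rw [AddMonoidAlgebra.coe_algebraMap]
        exact Finsupp.single_eq_of_ne (by omega)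
      rw [this]
      exact Submodule.zero_mem _

theorem T_mem_reesAlgebra (F : RingFiltration k B) :
    (LaurentPolynomial.T 1 : B[T;T⁻¹]) ∈ reesAlgebra F := by
  intro n
  by_cases hn : n ≤ 0
  · rw [F.step_nonpos n hn]
    exact Submodule.mem_top
  · have : (LaurentPolynomial.T 1 : B[T;T⁻¹]).coeff (-n) = 0 := by
      rw [LaurentPolynomial.T]
      exact Finsupp.single_eq_of_ne (by omega)
    rw [this]
    exact Submodule.zero_mem _

/-- The structure map `k[t] → ∑_n F^n t^{-n}`. -/
def reesParameter (F : RingFiltration k B) : k[X] →ₐ[k] reesAlgebra F :=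
  Polynomial.aeval ⟨LaurentPolynomial.T 1, T_mem_reesAlgebra F⟩

/-- The filtration of `A ⊆ ∏ k[x_i]` by weighted order of vanishing: `F^n` consists of the `f ∈ A`
all of whose monomials `x_i ^ m` have weight `w_i m ≥ n`, i.e. `w_i v_i(f) ≥ n` for all `i`. -/
def weightFiltration {s : ℕ} (A : Subalgebra k (Fin s → k[X])) (w : Fin s → ℕ) :
    RingFiltration k A where
  step n :=
    { carrier := {f | ∀ (i : Fin s) (m : ℕ), (f.1 i).coeff m ≠ 0 → n ≤ (w i : ℤ) * m}
      zero_mem' := by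
        intro i m h
        simp at h
      add_mem' := by
        intro f g hf hg i m h
        by_cases h1 : (f.1 i).coeff m = 0
        · by_cases h2 : (g.1 i).coeff m = 0
          · simp [h1, h2] at h
          · exact hg i m h2
        · exact hf i m h1
      smul_mem' := by
        intro c f hf i m h
        refine hf i m fun h1 => h ?_
        simp [h1] }
  antitone := fun _ _ hab _ hf i m h => hab.trans (hf i m h)
  step_nonpos := by
    intro n hn
    rw [eq_top_iff]
    intro f _ i m _
    exact hn.trans (by positivity)
  mul_mem := by
    intro a b f g hf hg i m h
    have h' : ((f.1 i) * (g.1 i)).coeff m ≠ 0 := h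
    rw [Polynomial.coeff_mul] at h'
    obtain ⟨x, hx, hne⟩ := Finset.exists_ne_zero_of_sum_ne_zero h'
    have h1 := hf i x.1 (left_ne_zero_of_mul hne)
    have h2 := hg i x.2 (right_ne_zero_of_mul hne)
    rw [← Finset.HasAntidiagonal.mem_antidiagonal.mp hx]
    push_cast
    linarith

end Rees

section Invariants

/-- The local `k`-algebra `O` is the local ring of a curve singularity with `r` branches and
`δ`-invariant `δ`: the normalization of its completion `R` is `∏_{i=1}^r k⟦x_i⟧`, and
`dim_k (∏ k⟦x_i⟧ / R) = δ`. -/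
def HasBranchesAndDelta (k O : Type*) [Field k] [CommRing O] [IsLocalRing O] [Algebra k O]
    (r δ : ℕ) : Prop :=
  ∃ φ : AdicCompletion (IsLocalRing.maximalIdeal O) O →ₐ[k] (Fin r → k⟦X⟧),
    IsNormalizationMap φ.toRingHom ∧
    Module.Finite k ((Fin r → k⟦X⟧) ⧸ LinearMap.range φ.toLinearMap) ∧
    Module.finrank k ((Fin r → k⟦X⟧) ⧸ LinearMap.range φ.toLinearMap) = δ

variable (k : Type u) [Field k]

/-- The affine line over `k`. -/
abbrev affineLine : Scheme.{u} := Spec (CommRingCat.of k[X])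

/-- The `k`-point `b` of the affine line. -/
def linePoint (b : k) : Spec (CommRingCat.of k) ⟶ affineLine k :=
  Spec.map (CommRingCat.ofHom (Polynomial.evalRingHom b))

/-- The structure morphism of the spectrum of a `k`-algebra. -/
def specStructure (B : Type u) [CommRing B] [Algebra k B] :
    Spec (CommRingCat.of B) ⟶ Spec (CommRingCat.of k) :=
  Spec.map (CommRingCat.ofHom (algebraMap k B))

variable {k}

/-- For a `k`-scheme `f : X ⟶ Spec k`, the ring homomorphism from `k` to the local ring at `x`. -/
def stalkStructure {X : Scheme.{u}} (f : X ⟶ Spec (CommRingCat.of k)) (x : X) :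
    k →+* X.presheaf.stalk x :=
  ((Scheme.ΓSpecIso (CommRingCat.of k)).inv ≫ f.appTop ≫ X.presheaf.germ ⊤ x trivial).hom

/-- The singularity `(X, x)` of the `k`-scheme `X` has `r` branches and `δ`-invariant `δ`. -/
def SchemeHasBranchesAndDelta {X : Scheme.{u}} (f : X ⟶ Spec (CommRingCat.of k)) (x : X)
    (r δ : ℕ) : Prop :=
  letI : Algebra k (X.presheaf.stalk x) := (stalkStructure f x).toAlgebra
  HasBranchesAndDelta k (X.presheaf.stalk x) r δ

/-- A connected affine (reduced, purely one-dimensional) curve over `k`. -/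
structure IsConnectedAffineCurve {X : Scheme.{u}} (f : X ⟶ Spec (CommRingCat.of k)) : Prop where
  isAffine : IsAffine X
  finiteType : LocallyOfFiniteType f
  isReduced : IsReduced X
  connected : ConnectedSpace X
  dim_eq_one : ∀ Z ∈ irreducibleComponents X, topologicalKrullDim Z = 1

/-- The fibre over the `k`-point `b` of a family over the affine line. -/
abbrev fibre {𝒴 : Scheme.{u}} (π : 𝒴 ⟶ affineLine k) (b : k) : Scheme.{u} :=
  pullback π (linePoint k b)

/-- The structure morphism of the fibre over `b` as a `k`-scheme. -/
abbrev fibreStructure {𝒴 : Scheme.{u}} (π : 𝒴 ⟶ affineLine k) (b : k) :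
    fibre π b ⟶ Spec (CommRingCat.of k) :=
  pullback.snd π (linePoint k b)

/-- The `k`-point of the fibre over `b` given by a section `σ`. -/
def sectionPoint {𝒴 : Scheme.{u}} (π : 𝒴 ⟶ affineLine k) (σ : affineLine k ⟶ 𝒴)
    (hσ : σ ≫ π = 𝟙 (affineLine k)) (b : k) : Spec (CommRingCat.of k) ⟶ fibre π b :=
  pullback.lift (linePoint k b ≫ σ) (𝟙 _) (by simp [hσ])

/-- The point `σ(b)` of the fibre over `b`. -/
def sectionAt {𝒴 : Scheme.{u}} (π : 𝒴 ⟶ affineLine k) (σ : affineLine k ⟶ 𝒴)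
    (hσ : σ ≫ π = 𝟙 (affineLine k)) (b : k) : fibre π b :=
  sectionPoint π σ hσ b (⊥ : PrimeSpectrum k)

/-- Isomorphism of `k`-schemes. -/
def IsIsoOver {X Y : Scheme.{u}} (f : X ⟶ Spec (CommRingCat.of k))
    (g : Y ⟶ Spec (CommRingCat.of k)) : Prop :=
  ∃ e : X ≅ Y, e.hom ≫ g = f

variable {s : ℕ}

/-- The total space of the Rees degeneration of `Spec A` with weights `w`. -/
abbrev reesTotal (A : Subalgebra k (Fin s → k[X])) (w : Fin s → ℕ) : Scheme.{u} :=
  Spec (CommRingCat.of (reesAlgebra (weightFiltration A w)))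

/-- The Rees degeneration of `Spec A` with weights `w`, as a family over the affine line. -/
def reesFamily (A : Subalgebra k (Fin s → k[X])) (w : Fin s → ℕ) :
    reesTotal A w ⟶ affineLine k :=
  Spec.map (CommRingCat.ofHom (reesParameter (weightFiltration A w)).toRingHom)

end Invariants

end MonomialDegeneration

end

namespace MonomialDegeneration

/-! ### Normalization maps onto a finite product of copies of a domain -/

section Integrality

variable {K R D : Type*} [CommRing K] [CommRing R] [CommRing D] [Algebra K R] [Algebra K D] {s : ℕ}

/-! Only two properties of `A` matter: it contains every tuple divisible by `x_i ^ N` in each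
coordinate, and its elements take one common value at the origins (`IsPinched`). The common value
comes from the equality of the ideals of the origins with `𝔪`. The power `N` comes from the
conductor: at a prime other than `𝔪`, regularity in dimension at most one makes integral fractions
locally regular, so the projection of the conductor to `k[x_i]` has no nonzero common root and
contains a power of `x_i` (`exists_isPinched`).

In the homogeneous coordinates `y_i = x_i t ^ (-w_i)` the extended Rees algebra becomes a subalgebra
of `∏ k[t][y_i]`, pinched over `k[t]` with the same `N` (`exists_reesEquiv`, `isPinched_reesModel`).
It is torsion-free, hence flat; it is of finite type by Artin–Tate; and inverting `y_i ^ N` on one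
branch gives `k[t][y_i, y_i⁻¹]`, whence smoothness off the section of pinched points.

The decisive fact is that this subalgebra is saturated with respect to `t - b`
(`mem_reesModel_of_sub_smul_mem`). It identifies the fibre over `b` with a pinched subalgebra of `∏
k[y_i]`. It also makes the quotient of `∏ k[t][y_i]` by the model torsion-free, so free of finite
rank over `k[t]`, and that rank is the `δ`-invariant of every fibre (`exists_finrank_eq`).
Completion at a pinched point does not change the codimension (`hasBranchesAndDelta_of_map`).

For `b ≠ 0` the substitution `x_i ↦ b ^ w_i x_i` recovers `A`. At `b = 0` the fibre is generated by
initial forms for the weights. With `w_i = (N + 1) ^ i`, nonconstant monomials of degree below `N`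
on different branches have different weights, so initial forms are monomials modulo the part of
degree at least `N`, which lies in the fibre anyway. -/

theorem isIntegral_of_pow_dvd_mem_range (φ : R →ₐ[K] (Fin s → D)) (x : D) {N : ℕ} (hN : 0 < N)
    (hx : ∀ d : D, ∃ c : K, x ∣ d - algebraMap K D c)
    (hφ : ∀ f : Fin s → D, (∀ i, x ^ N ∣ f i) → f ∈ φ.range) : φ.toRingHom.IsIntegral := by
  let := φ.toRingHom.toAlgebra
  -- The idempotents of the product are roots of `X ^ 2 - X`, so every tuple of constants is
  -- integral.
  have hconst (c : K) (i : Fin s) :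
      IsIntegral R (Pi.single i (algebraMap K D c) : Fin s → D) := by
    have h1 : IsIntegral R (Pi.single i (1 : D) : Fin s → D) := by
      refine ⟨Polynomial.X ^ 2 - Polynomial.X, ?_, ?_⟩
      · exact Polynomial.monic_X_pow_sub (by exact Polynomial.degree_X_le.trans_lt (by norm_num))
      · simp [Polynomial.eval₂_sub, sq, ← Pi.single_mul]
    have h2 : (Pi.single i (algebraMap K D c) : Fin s → D)
        = algebraMap R (Fin s → D) (algebraMap K R c) * Pi.single i 1 := by
      have : algebraMap R (Fin s → D) (algebraMap K R c) = algebraMap K (Fin s → D) c :=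
        φ.commutes c
      rw [this]
      ext j
      by_cases h : j = i
      · subst h; simp
      · simp [h]
    rw [h2]
    exact isIntegral_algebraMap.mul h1
  intro f
  change IsIntegral R f
  choose c hc using fun i => hx (f i)
  have hsum : IsIntegral R (∑ i, Pi.single i (algebraMap K D (c i)) : Fin s → D) :=
    IsIntegral.sum _ fun i _ => hconst _ _
  -- After its constants are removed, `f` is divisible by `x` in each coordinate, so its `N`-th
  -- power already lies in the range.
  have hpow : IsIntegral R ((f - ∑ i, Pi.single i (algebraMap K D (c i)) : Fin s → D) ^ N) := by
    obtain ⟨r, hr⟩ := hφ ((f - ∑ i, Pi.single i (algebraMap K D (c i))) ^ N) fun i => by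
      simp only [Pi.pow_apply, Pi.sub_apply, Finset.sum_apply, Finset.sum_pi_single,
        Finset.mem_univ, if_true]
      exact pow_dvd_pow_of_dvd (hc i) N
    rw [← hr]
    exact isIntegral_algebraMap (R := R)
  simpa using (IsIntegral.of_pow hN hpow).add hsum

/-- The constant tuple `x ^ N` is a single denominator that works for every element of the product.
-/
theorem isNormalizationMap_of_pow_dvd_mem_range [IsDomain D] (φ : R →ₐ[K] (Fin s → D))
    (hinj : Function.Injective φ) {x : D} (hx0 : x ≠ 0) {N : ℕ} (hN : 0 < N)
    (hx : ∀ d : D, ∃ c : K, x ∣ d - algebraMap K D c)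
    (hφ : ∀ f : Fin s → D, (∀ i, x ^ N ∣ f i) → f ∈ φ.range) :
    IsNormalizationMap φ.toRingHom := by
  refine ⟨hinj, isIntegral_of_pow_dvd_mem_range φ x hN hx hφ, fun f => ?_⟩
  obtain ⟨a, ha⟩ := hφ (fun _ => x ^ N) fun _ => dvd_rfl
  obtain ⟨c, hc⟩ := hφ (fun i => x ^ N * f i) fun _ => dvd_mul_right _ _
  refine ⟨a, c, ?_, ?_⟩
  · change φ a ∈ _
    have ha' : φ a = fun _ => x ^ N := ha
    rw [ha', mem_nonZeroDivisors_iff_right]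
    intro g hg
    ext i
    have := congrFun hg i
    simpa [hx0] using this
  · change φ a * f = φ c
    have ha' : φ a = fun _ => x ^ N := ha
    have hc' : φ c = fun i => x ^ N * f i := hc
    rw [ha', hc']
    rfl

end Integrality

/-- A subalgebra `B` of `∏ K[x_i]` with `∏ x_i ^ N K[x_i] ⊆ B` and all of whose elements take the
same value at the `s` origins: the coordinate ring of `s` affine lines with the origins pinched
together into one point. -/
structure IsPinched {K : Type*} [CommRing K] {s : ℕ} (N : ℕ)
    (B : Subalgebra K (Fin s → K[X])) : Prop where
  pos : 0 < N
  mem_of_dvd : ∀ f : Fin s → K[X], (∀ i, Polynomial.X ^ N ∣ f i) → f ∈ B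
  coeff_zero_eq : ∀ f ∈ B, ∀ i j, (f i).coeff 0 = (f j).coeff 0

/-! ### Pinched lines: finiteness, the pinched point, localization on a branch -/

namespace IsPinched

variable {K : Type*} [CommRing K] {s N : ℕ} {B : Subalgebra K (Fin s → K[X])}

theorem exists_X_dvd_sub (d : K[X]) : ∃ c : K, Polynomial.X ∣ d - algebraMap K K[X] c :=
  ⟨d.coeff 0, by simp [Polynomial.X_dvd_iff]⟩

theorem isIntegral (hB : IsPinched N B) : B.val.toRingHom.IsIntegral :=
  isIntegral_of_pow_dvd_mem_range B.val Polynomial.X hB.pos exists_X_dvd_sub fun f hf => by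
    simpa using hB.mem_of_dvd f hf

theorem isNormalizationMap [IsDomain K] (hB : IsPinched N B) :
    IsNormalizationMap B.val.toRingHom :=
  isNormalizationMap_of_pow_dvd_mem_range B.val Subtype.val_injective Polynomial.X_ne_zero hB.pos
    exists_X_dvd_sub fun f hf => by simpa using hB.mem_of_dvd f hf

theorem finiteType_pi (K : Type*) [CommRing K] (s : ℕ) : Algebra.FiniteType K (Fin s → K[X]) :=
  Algebra.FiniteType.trans (S := K[X]) inferInstance inferInstance

/-- Artin–Tate: the product of polynomial rings is of finite type over `K` and finite over `B`. -/
theorem finiteType [IsNoetherianRing K] (hB : IsPinched N B) : Algebra.FiniteType K B := by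
  have h1 := finiteType_pi K s
  have h2 : Algebra.FiniteType B (Fin s → K[X]) :=
    Algebra.FiniteType.of_restrictScalars_finiteType K B _
  have h3 : Algebra.IsIntegral B (Fin s → K[X]) := ⟨hB.isIntegral⟩
  have h4 : Module.Finite B (Fin s → K[X]) := Algebra.IsIntegral.finite
  exact ⟨fg_of_fg_of_fg K B (Fin s → K[X]) h1.1 h4.1 Subtype.val_injective⟩

/-- The value at the pinched point. -/
noncomputable def constCoeff (B : Subalgebra K (Fin s → K[X])) (i : Fin s) : B →ₐ[K] K :=
  (Polynomial.aeval (0 : K)).comp ((Pi.evalAlgHom K (fun _ : Fin s => K[X]) i).comp B.val)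

theorem constCoeff_apply (i : Fin s) (f : B) : constCoeff B i f = (f.1 i).coeff 0 := by
  simp [constCoeff, Polynomial.coeff_zero_eq_aeval_zero]

theorem constCoeff_surjective (i : Fin s) : Function.Surjective (constCoeff B i) := fun c =>
  ⟨algebraMap K B c, (constCoeff B i).commutes c⟩

theorem X_dvd_of_constCoeff_eq_zero (hB : IsPinched N B) {i : Fin s} {f : B}
    (hf : constCoeff B i f = 0) (j : Fin s) : Polynomial.X ∣ f.1 j := by
  rw [Polynomial.X_dvd_iff, hB.coeff_zero_eq _ f.2 j i, ← constCoeff_apply, hf]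

/-- The element of `B` that is `x_i ^ N` on the `i`-th line and vanishes on the others. -/
noncomputable def branchCoord (hB : IsPinched N B) (i : Fin s) : B :=
  ⟨Pi.single i (Polynomial.X ^ N), hB.mem_of_dvd _ fun j => by
    by_cases h : j = i
    · subst h; simp
    · simp [h]⟩

/-- A prime containing all the functions `branchCoord` contains the ideal of the pinched point. -/
theorem mem_of_branchCoord_mem (hB : IsPinched N B) {p : Ideal B} (hp : p.IsPrime)
    (h : ∀ i, hB.branchCoord i ∈ p) {i : Fin s} {f : B} (hf : constCoeff B i f = 0) : f ∈ p := by
  have hd := hB.X_dvd_of_constCoeff_eq_zero hf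
  choose g hg using hd
  -- In `f ^ (2 * N)` one factor `X ^ N` supplies the branch coordinate and the other keeps the
  -- cofactor inside `B`.
  refine hp.mem_of_pow_mem (2 * N) ?_
  have hmem (j : Fin s) : Pi.single j (Polynomial.X ^ N * g j ^ (2 * N)) ∈ B :=
    hB.mem_of_dvd _ fun l => by
      by_cases h : l = j
      · subst h; simp
      · simp [h]
  have : f ^ (2 * N) = ∑ j, hB.branchCoord j * ⟨_, hmem j⟩ := by
    ext1
    simp only [SubmonoidClass.coe_pow, branchCoord, AddSubmonoidClass.coe_finsetSum,
      MulMemClass.coe_mul, ← Pi.single_mul]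
    ext1 l
    simp only [Pi.pow_apply, Finset.sum_apply, Finset.sum_pi_single, Finset.mem_univ, if_true]
    rw [hg l]
    ring
  rw [this]
  exact Ideal.sum_mem _ fun j _ => Ideal.mul_mem_right _ _ (h j)

theorem branchCoord_constCoeff (hB : IsPinched N B) (i j : Fin s) :
    constCoeff B i (hB.branchCoord j) = 0 := by
  rw [constCoeff_apply]
  by_cases h : i = j
  · subst h; simp [branchCoord, hB.pos.ne]
  · simp [branchCoord, h]

/-- The `i`-th coordinate. -/
noncomputable def coord (B : Subalgebra K (Fin s → K[X])) (i : Fin s) : B →ₐ[K] K[X] :=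
  (Pi.evalAlgHom K (fun _ : Fin s => K[X]) i).comp B.val

/-- Inverting a function supported on one line discards the other lines, and on the remaining one
the pinching disappears once `X` is invertible. These charts cover the complement of the pinched
point. -/
theorem isLocalization_away (hB : IsPinched N B) (i : Fin s) :
    letI : Algebra B K[T;T⁻¹] := ((algebraMap K[X] K[T;T⁻¹]).comp (coord B i).toRingHom).toAlgebra
    IsLocalization.Away (hB.branchCoord i) K[T;T⁻¹] := by
  let : Algebra B K[T;T⁻¹] := ((algebraMap K[X] K[T;T⁻¹]).comp (coord B i).toRingHom).toAlgebra
  have hmap (f : B) : algebraMap B K[T;T⁻¹] f = Polynomial.toLaurent (f.1 i) := rfl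
  have hz : algebraMap B K[T;T⁻¹] (hB.branchCoord i) = LaurentPolynomial.T N := by
    simp [hmap, branchCoord]
  have hsingle (g : K[X]) : Pi.single i (Polynomial.X ^ N * g) ∈ B :=
    hB.mem_of_dvd _ fun l => by
      by_cases h : l = i
      · subst h; simp
      · simp [h]
  refine IsLocalization.Away.mk _ ?_ ?_ ?_
  · rw [hz]; exact LaurentPolynomial.isUnit_T _
  · intro q
    obtain ⟨n, f, hf⟩ := LaurentPolynomial.exists_T_pow q
    -- With `f = q T ^ n`, multiplying `q` by `T ^ (N * (n + 1))` leaves `X ^ N * X ^ (n * N - n) *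
    -- f`; the extra factor `X ^ N` ensures membership in `B`.
    refine ⟨n + 1, ⟨Pi.single i (Polynomial.X ^ N * (Polynomial.X ^ (n * N - n) * f)), hsingle _⟩, ?_⟩
    have hle' : n ≤ n * N := Nat.le_mul_of_pos_right _ hB.pos
    rw [hz, hmap]
    simp only [Pi.single_eq_same, map_mul, Polynomial.toLaurent_X_pow, hf, LaurentPolynomial.T_pow]
    rw [mul_comm q (LaurentPolynomial.T _), ← mul_assoc, ← mul_assoc, ← LaurentPolynomial.T_add,
      mul_right_comm, ← LaurentPolynomial.T_add]
    congr 2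
    push_cast [Nat.cast_sub hle']
    ring
  · intro a b hab
    refine ⟨1, ?_⟩
    rw [hmap, hmap, Polynomial.toLaurent_inj] at hab
    ext1
    simp only [pow_one, MulMemClass.coe_mul, branchCoord]
    ext1 l
    by_cases h : l = i
    · subst h; simp [hab]
    · simp [h]

end IsPinched

end MonomialDegeneration

/-! ### Dimension and connectedness of pinched lines -/

namespace MonomialDegeneration

/-- Lying over and going up lift a strict inclusion of primes of `R` to `S`; there the larger prime
is maximal, and contraction along an integral map preserves maximality. -/
theorem krullDimLE_one_of_isIntegral {R S : Type*} [CommRing R] [CommRing S] [Algebra R S]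
    [Algebra.IsIntegral R S] (hinj : Function.Injective (algebraMap R S)) [Ring.KrullDimLE 1 S] :
    Ring.KrullDimLE 1 R := by
  have hker : RingHom.ker (algebraMap R S) = ⊥ := (RingHom.injective_iff_ker_eq_bot _).mp hinj
  refine Ring.krullDimLE_one_iff.2 fun I hI ↦ or_iff_not_imp_left.2 fun hI' ↦ ?_
  rw [minimalPrimes_eq_minimals, Set.notMem_ofPred_iff, not_minimal_iff_exists_lt hI] at hI'
  obtain ⟨P, hlt, hP⟩ := hI'
  obtain ⟨q₀, -, hq₀, hq₀P⟩ := Ideal.exists_ideal_over_prime_of_isIntegral (S := S) P ⊥ (by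
    rw [← RingHom.ker_eq_comap_bot, hker]; exact bot_le)
  obtain ⟨q₁, hle, hq₁, hq₁I⟩ := Ideal.exists_ideal_over_prime_of_isIntegral (S := S) I q₀ (by
    rw [hq₀P]; exact hlt.le)
  have hlt' : q₀ < q₁ := by
    refine lt_of_le_of_ne hle ?_
    rintro rfl
    exact hlt.ne (hq₀P.symm.trans hq₁I)
  have hmax : q₁.IsMaximal := by
    refine (Ring.krullDimLE_one_iff.1 ‹_› q₁ hq₁).resolve_left ?_
    rw [minimalPrimes_eq_minimals, Set.notMem_ofPred_iff, not_minimal_iff_exists_lt hq₁]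
    exact ⟨q₀, hlt', hq₀⟩
  rw [← hq₁I]
  exact Ideal.isMaximal_comap_of_isIntegral_of_isMaximal q₁

theorem krullDimLE_one_pi (k : Type*) [Field k] (s : ℕ) : Ring.KrullDimLE 1 (Fin s → k[X]) := by
  infer_instance

theorem topologicalKrullDim_zeroLocus {R : Type*} [CommRing R] (I : Ideal R) :
    topologicalKrullDim (PrimeSpectrum.zeroLocus (I : Set R)) = ringKrullDim (R ⧸ I) := by
  have h := PrimeSpectrum.isClosedEmbedding_comap_of_surjective _ (Ideal.Quotient.mk I)
    Ideal.Quotient.mk_surjective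
  have hr : Set.range (PrimeSpectrum.comap (Ideal.Quotient.mk I))
      = PrimeSpectrum.zeroLocus (I : Set R) := by
    rw [range_comap_of_surjective _ _ Ideal.Quotient.mk_surjective, Ideal.mk_ker]
  rw [← PrimeSpectrum.topologicalKrullDim_eq_ringKrullDim, ← hr]
  exact (IsHomeomorph.topologicalKrullDim_eq _ h.isEmbedding.toHomeomorph.isHomeomorph).symm

namespace IsPinched

variable {k : Type*} [Field k] {s N : ℕ} {B : Subalgebra k (Fin s → k[X])}

theorem isReduced (B : Subalgebra k (Fin s → k[X])) : _root_.IsReduced B :=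
  isReduced_of_injective B.val Subtype.val_injective

theorem krullDimLE_one (hB : IsPinched N B) : Ring.KrullDimLE 1 B := by
  have h3 : Algebra.IsIntegral B (Fin s → k[X]) := ⟨hB.isIntegral⟩
  have := krullDimLE_one_pi k s
  exact krullDimLE_one_of_isIntegral (S := Fin s → k[X]) Subtype.val_injective

/-- A minimal prime is the kernel of a coordinate map, since these kernels intersect in zero. It is
not maximal, because the ideal of the pinched point contains it and also contains `branchCoord i`.
-/
theorem ringKrullDim_quotient (hB : IsPinched N B) {p : Ideal B} (hp : p ∈ minimalPrimes B) :
    ringKrullDim (B ⧸ p) = 1 := by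
  have hpp : p.IsPrime := hp.1.1
  have hker (i : Fin s) : (RingHom.ker (coord B i)).IsPrime := RingHom.ker_isPrime _
  obtain ⟨i, -, hi⟩ := (Ideal.IsPrime.inf_le' (s := Finset.univ)
    (f := fun i => RingHom.ker (coord B i)) hpp).1 (by
      intro f hf
      have : f = 0 := by
        ext1
        ext1 i
        have h := Finset.inf_le (f := fun i => RingHom.ker (coord B i)) (Finset.mem_univ i) hf
        exact h
      rw [this]; exact zero_mem _)
  have hpi : p = RingHom.ker (coord B i) :=
    le_antisymm (hp.2 ⟨hker i, bot_le⟩ hi) hi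
  have hnmax : ¬ p.IsMaximal := by
    intro hmax
    have hle : p ≤ RingHom.ker (constCoeff B i) := by
      rw [hpi]
      intro f hf
      have hf' : f.1 i = 0 := hf
      rw [RingHom.mem_ker, constCoeff_apply, hf', Polynomial.coeff_zero]
    have heq := hmax.eq_of_le (RingHom.ker_ne_top _) hle
    have hmem : hB.branchCoord i ∈ p := by
      rw [heq]; exact hB.branchCoord_constCoeff i i
    rw [hpi] at hmem
    have : (hB.branchCoord i).1 i = 0 := hmem
    simp [branchCoord] at this
  have := hB.krullDimLE_one
  apply eq_of_le_of_not_lt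
  · exact (ringKrullDim_quotient_le p).trans (Ring.krullDimLE_iff.1 this)
  · intro h'
    have h'' : ringKrullDim (B ⧸ p) ≤ 0 := Order.le_of_lt_succ h'
    rw [← Nat.cast_zero, ← Ring.krullDimLE_iff] at h''
    have hF : IsField (B ⧸ p) := Ring.KrullDimLE.isField_of_isDomain (R := B ⧸ p)
    exact hnmax (Ideal.Quotient.maximal_of_isField _ hF)

theorem topologicalKrullDim_eq_one (hB : IsPinched N B) :
    ∀ Z ∈ irreducibleComponents (PrimeSpectrum B), topologicalKrullDim Z = 1 := by
  intro Z hZ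
  rw [← PrimeSpectrum.zeroLocus_minimalPrimes] at hZ
  obtain ⟨p, hp, rfl⟩ := hZ
  change topologicalKrullDim (PrimeSpectrum.zeroLocus (p : Set B)) = 1
  rw [topologicalKrullDim_zeroLocus, hB.ringKrullDim_quotient hp]

/-- An idempotent is `0` or `1` on each line, and the common value at the origins forces the same
choice on all lines. -/
theorem connectedSpace (hB : IsPinched N B) (i : Fin s) : ConnectedSpace (PrimeSpectrum B) := by
  have : Nontrivial B := (constCoeff B i).toRingHom.domain_nontrivial
  have hpre : PreconnectedSpace (PrimeSpectrum B) := by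
    rw [preconnectedSpace_iff_clopen]
    intro U hU
    obtain ⟨e, he, rfl⟩ := PrimeSpectrum.isClopen_iff.1 hU
    have hidem (j : Fin s) : e.1 j = 0 ∨ e.1 j = 1 := by
      have : IsIdempotentElem (e.1 j) := congrFun (congrArg Subtype.val he) j
      exact IsIdempotentElem.iff_eq_zero_or_one.1 this
    have hcst (j : Fin s) : e.1 j = e.1 i := by
      have h := hB.coeff_zero_eq _ e.2 j i
      rcases hidem j with h1 | h1 <;> rcases hidem i with h2 | h2 <;> rw [h1, h2] at h ⊢ <;>
        simp at h
    rcases hidem i with h | h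
    · left
      have : e = 0 := by ext1; ext1 j; rw [hcst, h]; rfl
      simp [this]
    · right
      have : e = 1 := by ext1; ext1 j; rw [hcst, h]; rfl
      simp [this]
  exact { hpre with toNonempty := inferInstance }

end IsPinched

end MonomialDegeneration

/-! ### Completion at the pinched point: branches and the `δ`-invariant -/

namespace MonomialDegeneration

section Completion

variable {k O : Type*} [Field k] [CommRing O] [Algebra k O] {s : ℕ}

theorem evalₐ_eq_mk_of_le {I : Ideal O} {m n : ℕ} (hmn : m ≤ n) {x : AdicCompletion I O} {r : O}
    (h : AdicCompletion.evalₐ I n x = Ideal.Quotient.mk (I ^ n) r) :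
    AdicCompletion.evalₐ I m x = Ideal.Quotient.mk (I ^ m) r := by
  obtain ⟨f, rfl⟩ := AdicCompletion.mk_surjective I O x
  rw [AdicCompletion.evalₐ_mk, Ideal.Quotient.eq] at h
  exact (AdicCompletion.evalₐ_mk I m f).trans ((AdicCompletion.Ideal.mk_eq_mk I hmn f).symm.trans
    (Ideal.Quotient.eq.2 (Ideal.pow_le_pow_right hmn h)))

/-- The map to `k⟦x⟧` induced on the `I`-adic completion by a map that sends `I` into `(x)`. -/
theorem exists_completionLift (I : Ideal O) (ψ : O →ₐ[k] k⟦X⟧)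
    (hψ : ∀ r ∈ I, (PowerSeries.X : k⟦X⟧) ∣ ψ r) :
    ∃ φ : AdicCompletion I O →ₐ[k] k⟦X⟧, ∀ (n : ℕ) (x : AdicCompletion I O) (r : O),
      AdicCompletion.evalₐ I n x = Ideal.Quotient.mk (I ^ n) r →
        (PowerSeries.X : k⟦X⟧) ^ n ∣ φ x - ψ r := by
  let J : Ideal k⟦X⟧ := Ideal.span {PowerSeries.X}
  have hJ (n : ℕ) : I ^ n ≤ (J ^ n).comap ψ := by
    have : I ≤ J.comap ψ := fun r hr => Ideal.mem_span_singleton.2 (hψ r hr)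
    exact (Ideal.pow_right_mono this n).trans (Ideal.le_comap_pow ψ n)
  let f (n : ℕ) : AdicCompletion I O →ₐ[k] k⟦X⟧ ⧸ J ^ n :=
    (Ideal.quotientMapₐ (J ^ n) ψ (hJ n)).comp ((AdicCompletion.evalₐ I n).restrictScalars k)
  have hfr (n : ℕ) (x : AdicCompletion I O) (r : O)
      (hr : AdicCompletion.evalₐ I n x = Ideal.Quotient.mk (I ^ n) r) :
      f n x = Ideal.Quotient.mk (J ^ n) (ψ r) := by
    change Ideal.quotientMapₐ (J ^ n) ψ (hJ n) (AdicCompletion.evalₐ I n x) = _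
    rw [hr]
    rfl
  have hf {m n : ℕ} (hle : m ≤ n) :
      (Ideal.Quotient.factorₐ k (Ideal.pow_le_pow_right hle)).comp (f n) = f m := by
    ext x
    obtain ⟨r, hr⟩ := Ideal.Quotient.mk_surjective (AdicCompletion.evalₐ I n x)
    have hr' : AdicCompletion.evalₐ I m x = Ideal.Quotient.mk (I ^ m) r :=
      evalₐ_eq_mk_of_le hle hr.symm
    rw [AlgHom.comp_apply, hfr n x r hr.symm, hfr m x r hr']
    rfl
  refine ⟨IsAdicComplete.liftAlgHom J f hf, fun n x r hr => ?_⟩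
  have h := IsAdicComplete.mk_liftAlgHom J f hf n x
  rw [hfr n x r hr, Ideal.Quotient.eq, Ideal.span_singleton_pow, Ideal.mem_span_singleton] at h
  exact h

theorem powerSeries_eq_zero_of_forall_X_pow_dvd {f : k⟦X⟧}
    (h : ∀ n, (PowerSeries.X : k⟦X⟧) ^ n ∣ f) : f = 0 := by
  ext n
  simpa using PowerSeries.X_pow_dvd_iff.1 (h (n + 1)) n (Nat.lt_succ_self n)

end Completion

theorem X_pow_dvd_coe_iff {k : Type*} [CommRing k] (n : ℕ) (f : k[X]) :
    (PowerSeries.X : k⟦X⟧) ^ n ∣ (f : k⟦X⟧) ↔ Polynomial.X ^ n ∣ f := by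
  rw [PowerSeries.X_pow_dvd_iff, Polynomial.X_pow_dvd_iff]
  simp

namespace IsPinched

/-- Remainders modulo `X ^ N` represent every class. -/
theorem finite_quotient {K : Type*} [CommRing K] {s N : ℕ} {B : Subalgebra K (Fin s → K[X])}
    (hB : IsPinched N B) : Module.Finite K ((Fin s → K[X]) ⧸ Subalgebra.toSubmodule B) := by
  let g : (Fin s → Polynomial.degreeLT K N) →ₗ[K] (Fin s → K[X]) :=
    LinearMap.pi fun i => (Polynomial.degreeLT K N).subtype ∘ₗ LinearMap.proj i
  have : Module.Finite K (Polynomial.degreeLT K N) :=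
    Module.Finite.equiv (Polynomial.degreeLTEquiv K N).symm
  refine Module.Finite.of_surjective ((Subalgebra.toSubmodule B).mkQ ∘ₗ g) fun q => ?_
  obtain ⟨f, rfl⟩ := Submodule.mkQ_surjective _ q
  cases subsingleton_or_nontrivial K
  · exact ⟨0, Subsingleton.elim _ _⟩
  have hm : (Polynomial.X ^ N : K[X]).Monic := Polynomial.monic_X_pow N
  refine ⟨fun i => ⟨f i %ₘ Polynomial.X ^ N, ?_⟩, ?_⟩
  · rw [Polynomial.mem_degreeLT]
    simpa using Polynomial.degree_modByMonic_lt (f i) hm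
  · rw [LinearMap.comp_apply, Submodule.mkQ_apply, Submodule.mkQ_apply, Submodule.Quotient.eq]
    refine hB.mem_of_dvd _ fun i => ?_
    change Polynomial.X ^ N ∣ f i %ₘ Polynomial.X ^ N - f i
    rw [dvd_sub_comm]
    refine ⟨f i /ₘ Polynomial.X ^ N, ?_⟩
    rw [sub_eq_iff_eq_add, add_comm]
    exact (Polynomial.modByMonic_add_div (f i) _).symm

variable {k : Type*} [Field k] {s N : ℕ} {B : Subalgebra k (Fin s → k[X])}

/-- Polynomials as power series, coordinatewise. -/
noncomputable def toPowerSeries (k : Type*) [Field k] (s : ℕ) :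
    (Fin s → k[X]) →ₐ[k] (Fin s → k⟦X⟧) :=
  AlgHom.pi fun i =>
    (Polynomial.coeToPowerSeries.algHom k).comp (Pi.evalAlgHom k (fun _ : Fin s => k[X]) i)

@[simp] theorem toPowerSeries_apply (f : Fin s → k[X]) (i : Fin s) :
    toPowerSeries k s f i = (f i : k⟦X⟧) := by
  simp [toPowerSeries, Polynomial.coeToPowerSeries.algHom_apply]

/-- The hypotheses `hmax` and `hpow` make the maximal-adic topology of `O` agree with the `X`-adic
topology through `ψ`. The completion is therefore the `X`-adic closure of the image, that is, the
power series tuples congruent modulo `X ^ N` to an element of `B`. Polynomials represent all classes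
modulo this closure, so the codimension is that of `B`. -/
theorem hasBranchesAndDelta_of_map (hB : IsPinched N B) {O : Type*} [CommRing O] [IsLocalRing O]
    [Algebra k O] (ψ : O →ₐ[k] (Fin s → k⟦X⟧))
    (hmax : ∀ r ∈ IsLocalRing.maximalIdeal O, ∀ i, (PowerSeries.X : k⟦X⟧) ∣ ψ r i)
    (hpow : ∀ (j : ℕ) (r : O), (∀ i, (PowerSeries.X : k⟦X⟧) ^ (N * j) ∣ ψ r i) →
      r ∈ IsLocalRing.maximalIdeal O ^ j)
    (hmem : ∀ r : O, ∃ b ∈ B, ∀ i, (PowerSeries.X : k⟦X⟧) ^ N ∣ ψ r i - (b i : k⟦X⟧))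
    (hsurj : ∀ b ∈ B, ∃ r : O, ψ r = toPowerSeries k s b) :
    HasBranchesAndDelta k O s (Module.finrank k ((Fin s → k[X]) ⧸ Subalgebra.toSubmodule B)) := by
  let I := IsLocalRing.maximalIdeal O
  choose φ' hφ' using fun i : Fin s => exists_completionLift I
    ((Pi.evalAlgHom k (fun _ : Fin s => k⟦X⟧) i).comp ψ) fun r hr => hmax r hr i
  let φ : AdicCompletion I O →ₐ[k] (Fin s → k⟦X⟧) := AlgHom.pi φ'
  have hφ (n : ℕ) (x : AdicCompletion I O) (r : O)
      (hr : AdicCompletion.evalₐ I n x = Ideal.Quotient.mk (I ^ n) r) (i : Fin s) :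
      (PowerSeries.X : k⟦X⟧) ^ n ∣ φ x i - ψ r i := hφ' i n x r hr
  have hinj : Function.Injective φ := by
    rw [injective_iff_map_eq_zero]
    intro x hx
    refine AdicCompletion.ext_evalₐ fun j => ?_
    obtain ⟨r, hr⟩ := Ideal.Quotient.mk_surjective (AdicCompletion.evalₐ I (N * j) x)
    have hle : j ≤ N * j := Nat.le_mul_of_pos_left _ hB.pos
    have hr' : r ∈ I ^ j := hpow j r fun i => by
      have := hφ _ x r hr.symm i
      rw [hx] at this
      simpa using this
    rw [evalₐ_eq_mk_of_le hle hr.symm, map_zero]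
    exact Ideal.Quotient.eq_zero_iff_mem.2 hr'
  have hrange (f : Fin s → k⟦X⟧) : f ∈ φ.range ↔
      ∃ b ∈ B, ∀ i, (PowerSeries.X : k⟦X⟧) ^ N ∣ f i - (b i : k⟦X⟧) := by
    constructor
    · rintro ⟨x, rfl⟩
      obtain ⟨r, hr⟩ := Ideal.Quotient.mk_surjective (AdicCompletion.evalₐ I N x)
      obtain ⟨b, hb, hb'⟩ := hmem r
      refine ⟨b, hb, fun i => ?_⟩
      have := dvd_add (hφ N x r hr.symm i) (hb' i)
      rwa [sub_add_sub_cancel] at this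
    · rintro ⟨b, hb, hbf⟩
      have htr (m : ℕ) (i : Fin s) :
          (PowerSeries.X : k⟦X⟧) ^ m ∣ f i - (PowerSeries.trunc m (f i) : k⟦X⟧) := by
        rw [PowerSeries.X_pow_dvd_iff]
        intro l hl
        simp [PowerSeries.coeff_trunc, hl]
      -- Truncations of `f` differ from `b` by multiples of `X ^ N`, so they lie in `B` and lift to
      -- `O`; the lifts form a Cauchy sequence.
      have hex (n : ℕ) : ∃ r : O, ∀ i, (PowerSeries.X : k⟦X⟧) ^ (N * (n + 1)) ∣ f i - ψ r i := by
        let t : Fin s → k[X] := fun i => PowerSeries.trunc (N * (n + 1)) (f i)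
        have ht : t ∈ B := by
          have : t - b ∈ B := hB.mem_of_dvd _ fun i => by
            rw [← X_pow_dvd_coe_iff]
            have h1 := (pow_dvd_pow _ (Nat.le_mul_of_pos_right N (Nat.succ_pos n))).trans
              (htr (N * (n + 1)) i)
            have h2 := dvd_sub (hbf i) h1
            rw [sub_sub_sub_cancel_left] at h2
            simpa [t] using h2
          simpa using B.add_mem this hb
        obtain ⟨r, hr⟩ := hsurj t ht
        exact ⟨r, fun i => by rw [hr, toPowerSeries_apply]; exact htr _ i⟩
      choose r hr using hex
      have hcauchy (n : ℕ) : r n ≡ r (n + 1) [SMOD (I ^ n • ⊤ : Submodule O O)] := by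
        rw [SModEq.sub_mem, smul_eq_mul, Ideal.mul_top]
        refine hpow n _ fun i => ?_
        have h1 := dvd_sub ((pow_dvd_pow _ (Nat.mul_le_mul_left N (Nat.le_add_right _ 2))).trans
          (hr (n + 1) i)) ((pow_dvd_pow _ (Nat.mul_le_mul_left N (Nat.le_succ n))).trans (hr n i))
        rw [sub_sub_sub_cancel_left] at h1
        simpa using h1
      refine ⟨AdicCompletion.mk I O (AdicCompletion.AdicCauchySequence.mk I O r hcauchy), ?_⟩
      ext1 i
      rw [← sub_eq_zero]
      refine powerSeries_eq_zero_of_forall_X_pow_dvd fun n => ?_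
      have h1 := hφ n (AdicCompletion.mk I O (AdicCompletion.AdicCauchySequence.mk I O r hcauchy))
        (r n) (AdicCompletion.evalₐ_mk I n _) i
      have hle : n ≤ N * (n + 1) := (Nat.le_succ n).trans (Nat.le_mul_of_pos_left _ hB.pos)
      have h2 := dvd_sub h1 ((pow_dvd_pow _ hle).trans (hr n i))
      rwa [sub_sub_sub_cancel_right] at h2
  have hnorm : IsNormalizationMap φ.toRingHom := by
    refine isNormalizationMap_of_pow_dvd_mem_range φ hinj PowerSeries.X_ne_zero hB.pos ?_ ?_
    · intro d
      refine ⟨PowerSeries.constantCoeff d, ?_⟩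
      rw [PowerSeries.X_dvd_iff]
      simp
    · intro f hf
      exact (hrange f).2 ⟨0, B.zero_mem, fun i => by simpa using hf i⟩
  let L : (Fin s → k[X]) →ₗ[k] (Fin s → k⟦X⟧) ⧸ LinearMap.range φ.toLinearMap :=
    (LinearMap.range φ.toLinearMap).mkQ ∘ₗ (toPowerSeries k s).toLinearMap
  have hmemL (f : Fin s → k⟦X⟧) : f ∈ LinearMap.range φ.toLinearMap ↔ f ∈ φ.range := Iff.rfl
  have hker : LinearMap.ker L = Subalgebra.toSubmodule B := by
    ext f
    rw [LinearMap.mem_ker, LinearMap.comp_apply, Submodule.mkQ_apply, Submodule.Quotient.mk_eq_zero,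
      hmemL, hrange]
    constructor
    · rintro ⟨b, hb, hbf⟩
      have : f - b ∈ B := hB.mem_of_dvd _ fun i => by
        rw [← X_pow_dvd_coe_iff]
        simpa using hbf i
      simpa using B.add_mem this hb
    · intro hf
      exact ⟨f, hf, fun i => by simp⟩
  have hLsurj : Function.Surjective L := by
    intro q
    obtain ⟨f, rfl⟩ := Submodule.mkQ_surjective _ q
    refine ⟨fun i => PowerSeries.trunc N (f i), ?_⟩
    rw [LinearMap.comp_apply, Submodule.mkQ_apply, Submodule.mkQ_apply, Submodule.Quotient.eq,
      hmemL, hrange]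
    refine ⟨0, B.zero_mem, fun i => ?_⟩
    rw [PowerSeries.X_pow_dvd_iff]
    intro l hl
    simp [PowerSeries.coeff_trunc, hl]
  let e : ((Fin s → k[X]) ⧸ Subalgebra.toSubmodule B) ≃ₗ[k] _ :=
    (Submodule.quotEquivOfEq _ _ hker.symm).trans (L.quotKerEquivOfSurjective hLsurj)
  have := hB.finite_quotient
  exact ⟨φ, hnorm, Module.Finite.equiv e, e.finrank_eq.symm⟩

/-- A tuple divisible by `X ^ (N * (j + 1))` is a product of `j + 1` elements divisible by `X ^ N`,
each of which lies in `B` and vanishes at the pinched point. -/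
theorem mem_ker_pow (hB : IsPinched N B) (i : Fin s) {f : B} {j : ℕ}
    (hf : ∀ l, Polynomial.X ^ (N * j) ∣ f.1 l) : f ∈ RingHom.ker (constCoeff B i) ^ j := by
  cases j with
  | zero => simp
  | succ j =>
    choose g hg using hf
    have hmem (h : Fin s → k[X]) : (fun l => Polynomial.X ^ N * h l) ∈ B :=
      hB.mem_of_dvd _ fun l => dvd_mul_right _ _
    have hker (h : Fin s → k[X]) : (⟨_, hmem h⟩ : B) ∈ RingHom.ker (constCoeff B i) := by
      rw [RingHom.mem_ker, constCoeff_apply, Polynomial.mul_coeff_zero]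
      simp [hB.pos.ne]
    have : f = (⟨_, hmem 1⟩ : B) ^ j * ⟨_, hmem g⟩ := by
      ext1
      ext1 l
      simp only [hg, MulMemClass.coe_mul, SubmonoidClass.coe_pow, Pi.mul_apply, Pi.pow_apply,
        Pi.one_apply, mul_one]
      ring
    rw [this, pow_succ]
    exact Ideal.mul_mem_mul (Ideal.pow_mem_pow (hker 1) j) (hker g)

/-- A denominator outside `p` has the same nonzero constant term on every branch, so it is
invertible in the power series ring and fractions expand as power series. -/
theorem hasBranchesAndDelta_of_isLocalization (hB : IsPinched N B) (i : Fin s)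
    {O : Type*} [CommRing O] [IsLocalRing O] [Algebra k O] [Algebra B O] [IsScalarTower k B O]
    (p : Ideal B) [p.IsPrime] (hp : p = RingHom.ker (constCoeff B i))
    [IsLocalization.AtPrime O p] :
    HasBranchesAndDelta k O s (Module.finrank k ((Fin s → k[X]) ⧸ Subalgebra.toSubmodule B)) := by
  have hu (u : B) (hu : u ∉ p) : (u.1 i).coeff 0 ≠ 0 := by
    rwa [hp, RingHom.mem_ker, constCoeff_apply] at hu
  have hunit (u : p.primeCompl) :
      IsUnit (((toPowerSeries k s).comp B.val : B →ₐ[k] _) u) := by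
    rw [Pi.isUnit_iff]
    intro j
    rw [PowerSeries.isUnit_iff_constantCoeff]
    have := hu u.1 u.2
    rw [hB.coeff_zero_eq _ u.1.2 i j] at this
    simpa using this
  let ψ : O →ₐ[k] (Fin s → k⟦X⟧) := IsLocalization.liftAlgHom (M := p.primeCompl)
    (f := ((toPowerSeries k s).comp B.val : B →ₐ[k] _)) hunit
  have hψ (a : B) : ψ (algebraMap B O a) = toPowerSeries k s a :=
    IsLocalization.lift_eq hunit a
  have hdvd (r : O) (a : B) (u : p.primeCompl) (h : r * algebraMap B O u = algebraMap B O a)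
      (n : ℕ) (j : Fin s) : (PowerSeries.X : k⟦X⟧) ^ n ∣ ψ r j ↔ Polynomial.X ^ n ∣ a.1 j := by
    have h1 := congrFun (congrArg ψ h) j
    rw [map_mul, hψ, hψ, Pi.mul_apply] at h1
    have h2 := Pi.isUnit_iff.1 (hunit u) j
    rw [← X_pow_dvd_coe_iff, ← toPowerSeries_apply a.1 j, ← h1]
    exact h2.dvd_mul_right.symm
  refine hB.hasBranchesAndDelta_of_map ψ ?_ ?_ ?_ ?_
  · intro r hr j
    obtain ⟨⟨a, u⟩, h⟩ := IsLocalization.surj p.primeCompl r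
    rw [← pow_one PowerSeries.X, hdvd r a u h, pow_one]
    have ha : a ∈ p := by
      rw [← IsLocalization.AtPrime.to_map_mem_maximal_iff O p a, ← h]
      exact Ideal.mul_mem_right _ _ hr
    rw [hp] at ha
    exact hB.X_dvd_of_constCoeff_eq_zero ha j
  · intro n r hr
    obtain ⟨⟨a, u⟩, h⟩ := IsLocalization.surj p.primeCompl r
    have ha : a ∈ p ^ n := by
      rw [hp]
      exact hB.mem_ker_pow i fun l => (hdvd r a u h _ l).1 (hr l)
    have ha' : algebraMap B O a ∈ IsLocalRing.maximalIdeal O ^ n := by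
      rw [← IsLocalization.AtPrime.map_eq_maximalIdeal p O, ← Ideal.map_pow]
      exact Ideal.mem_map_of_mem _ ha
    rw [← h] at ha'
    exact (Ideal.mul_unit_mem_iff_mem _ (IsLocalization.map_units O u)).1 ha'
  · intro r
    obtain ⟨⟨a, u⟩, h⟩ := IsLocalization.surj p.primeCompl r
    have hc := hu u.1 u.2
    set c := (u.1.1 i).coeff 0 with hcdef
    -- Since `y` vanishes at the pinched point, the geometric sum up to `y ^ (N - 1)` inverts `u`
    -- inside `B` modulo `X ^ N`.
    let y : B := 1 - algebraMap k B c⁻¹ * u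
    obtain ⟨v, huv⟩ : ∃ v : B, u.1 * v = 1 - y ^ N := by
      refine ⟨algebraMap k B c⁻¹ * ∑ l ∈ Finset.range N, y ^ l, ?_⟩
      have h1 : (u.1 * algebraMap k B c⁻¹) = 1 - y := by simp only [y]; ring
      rw [← mul_neg_geom_sum, ← h1, mul_assoc]
    have hy (j : Fin s) : Polynomial.X ∣ y.1 j := by
      refine hB.X_dvd_of_constCoeff_eq_zero (i := i) ?_ j
      simp only [y, map_sub, map_one, map_mul, AlgHom.commutes, constCoeff_apply, ← hcdef]
      simp [hc]
    refine ⟨(a * v).1, (a * v).2, fun j => ?_⟩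
    have h1 : ψ r - toPowerSeries k s (a * v).1 = ψ r * toPowerSeries k s (y ^ N).1 := by
      rw [← hψ, ← hψ]
      have hy' : y ^ N = 1 - u.1 * v := by rw [huv]; ring
      rw [hy', ← map_sub, ← map_mul]
      congr 1
      rw [map_sub, map_mul (algebraMap B O) a, map_mul (algebraMap B O) u.1, ← h, map_one]
      ring
    have h2 := congrFun h1 j
    rw [Pi.sub_apply, Pi.mul_apply, toPowerSeries_apply, toPowerSeries_apply] at h2
    rw [h2]
    refine dvd_mul_of_dvd_right ?_ _
    rw [X_pow_dvd_coe_iff]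
    exact pow_dvd_pow_of_dvd (hy j) N
  · intro b hb
    exact ⟨algebraMap B O ⟨b, hb⟩, hψ _⟩

end IsPinched

end MonomialDegeneration

/-! ### Regular points and the conductor of a rational curve -/

namespace MonomialDegeneration

/-- By Krull's intersection theorem a nonzero element has a largest power of the maximal ideal
containing it, and the cofactor is then a unit. -/
theorem exists_eq_mul_pow_of_isPrincipal {R : Type*} [CommRing R] [IsLocalRing R]
    [IsNoetherianRing R] {π : R} (hπ : IsLocalRing.maximalIdeal R = Ideal.span {π}) {x : R}
    (hx : x ≠ 0) : ∃ (n : ℕ) (y : R), IsUnit y ∧ x = y * π ^ n := by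
  have hex : ∃ n, x ∉ IsLocalRing.maximalIdeal R ^ n := by
    by_contra! h
    apply hx
    have : x ∈ (⨅ n : ℕ, IsLocalRing.maximalIdeal R ^ n) := by simpa using h
    rwa [Ideal.iInf_pow_eq_bot_of_isLocalRing _ (Ideal.IsPrime.ne_top')] at this
  classical
  obtain ⟨n, hn⟩ : ∃ n, Nat.find hex = n + 1 := by
    refine Nat.exists_eq_succ_of_ne_zero fun h => ?_
    have := Nat.find_spec hex
    rw [h] at this
    simp at this
  have h1 : x ∈ IsLocalRing.maximalIdeal R ^ n := by
    by_contra h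
    have := Nat.find_min' hex h
    omega
  have h2 : x ∉ IsLocalRing.maximalIdeal R ^ (n + 1) := hn ▸ Nat.find_spec hex
  rw [hπ, Ideal.span_singleton_pow, Ideal.mem_span_singleton'] at h1 h2
  obtain ⟨y, hy⟩ := h1
  refine ⟨n, y, ?_, hy.symm⟩
  by_contra hu
  have hy' : y ∈ IsLocalRing.maximalIdeal R := hu
  rw [hπ, Ideal.mem_span_singleton'] at hy'
  obtain ⟨z, rfl⟩ := hy'
  exact h2 ⟨z, by rw [← hy]; ring⟩

theorem maximalIdeal_isPrincipal_of_krullDimLE_one (R : Type*) [CommRing R] [IsRegularLocalRing R]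
    [h : Ring.KrullDimLE 1 R] : ∃ π : R, IsLocalRing.maximalIdeal R = Ideal.span {π} := by
  have h1 : (IsLocalRing.maximalIdeal R).spanFinrank ≤ 1 := by
    have := IsRegularLocalRing.spanFinrank_maximalIdeal (R := R)
    have h2 := Ring.krullDimLE_iff.1 h
    rw [← this] at h2
    exact_mod_cast h2
  rcases Nat.le_one_iff_eq_zero_or_eq_one.1 h1 with h0 | h0
  · rw [Submodule.spanFinrank_eq_zero_iff_eq_bot (IsNoetherian.noetherian _)] at h0
    exact ⟨0, by rw [h0, Ideal.span_singleton_zero]⟩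
  · rw [Submodule.spanFinrank_eq_one_iff] at h0
    exact h0.1.principal

/-- At a regular prime `p` of a ring of dimension at most one, every element is locally either `0`
or a unit times a power of a fixed uniformizer. -/
theorem exists_uniformizer {R : Type*} [CommRing R] [Ring.KrullDimLE 1 R] (p : Ideal R) [p.IsPrime]
    [IsRegularLocalRing (Localization.AtPrime p)] :
    ∃ t ∈ p, ∀ a : R, (∃ v ∉ p, v * a = 0) ∨
      ∃ m : ℕ, ∃ v ∉ p, ∃ v' ∉ p, v * a = v' * t ^ m := by
  let Rp := Localization.AtPrime p
  have hdim : Ring.KrullDimLE 1 Rp := by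
    rw [Ring.krullDimLE_iff, IsLocalization.AtPrime.ringKrullDim_eq_height p Rp]
    exact (Ideal.height_le_ringKrullDim_of_ne_top Ideal.IsPrime.ne_top').trans
      (Ring.krullDimLE_iff.1 ‹_›)
  obtain ⟨π, hπ⟩ := maximalIdeal_isPrincipal_of_krullDimLE_one Rp
  obtain ⟨⟨t, w⟩, htw⟩ := IsLocalization.surj p.primeCompl π
  dsimp only at htw
  have ht : IsLocalRing.maximalIdeal Rp = Ideal.span {algebraMap R Rp t} := by
    rw [hπ, ← htw, Ideal.span_singleton_mul_right_unit (IsLocalization.map_units Rp w)]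
  refine ⟨t, ?_, fun a => ?_⟩
  · rw [← IsLocalization.AtPrime.to_map_mem_maximal_iff Rp p t, ht]
    exact Ideal.mem_span_singleton_self _
  · by_cases ha : algebraMap R Rp a = 0
    · left
      obtain ⟨v, hv⟩ := (IsLocalization.map_eq_zero_iff p.primeCompl Rp a).1 ha
      exact ⟨v.1, v.2, hv⟩
    · right
      obtain ⟨m, y, hy, hay⟩ := exists_eq_mul_pow_of_isPrincipal ht ha
      obtain ⟨⟨b, w'⟩, hb⟩ := IsLocalization.surj p.primeCompl y
      dsimp only at hb
      have hbp : b ∉ p := by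
        rw [← IsLocalization.AtPrime.to_map_mem_maximal_iff Rp p b, ← hb,
          IsLocalRing.mem_maximalIdeal, mem_nonunits_iff, not_not]
        exact hy.mul (IsLocalization.map_units Rp w')
      have heq : algebraMap R Rp (w'.1 * a) = algebraMap R Rp (b * t ^ m) := by
        rw [map_mul, map_mul, map_pow, ← hb, hay]; ring
      obtain ⟨z, hz⟩ := (IsLocalization.eq_iff_exists p.primeCompl Rp).1 heq
      refine ⟨m, z.1 * w'.1, p.primeCompl.mul_mem z.2 w'.2, z.1 * b,
        p.primeCompl.mul_mem z.2 hbp, ?_⟩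
      rw [mul_assoc, hz, mul_assoc]

/-- At a regular prime of a ring of dimension at most one, an integral fraction is regular. -/
theorem exists_mul_mem_range_of_isRegular {R S : Type*} [CommRing R] [CommRing S] [Algebra R S]
    [Algebra.IsIntegral R S] (hinj : Function.Injective (algebraMap R S)) [Ring.KrullDimLE 1 R]
    (p : Ideal R) [hp : p.IsPrime] [IsRegularLocalRing (Localization.AtPrime p)]
    {f : S} {a c : R} (ha : algebraMap R S a ∈ nonZeroDivisors S)
    (hf : algebraMap R S a * f = algebraMap R S c) :
    ∃ u ∉ p, ∃ g : R, algebraMap R S u * f = algebraMap R S g := by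
  have hcancel (x : S) (hx : algebraMap R S a * x = 0) : x = 0 :=
    (mul_left_mem_nonZeroDivisors_eq_zero_iff ha).1 hx
  obtain ⟨t, htp, ht⟩ := exists_uniformizer p
  rcases ht a with ⟨v, hv, hva⟩ | ⟨m, v, hv, v', hv', hva⟩
  · exfalso
    apply hv
    have : algebraMap R S v = 0 := hcancel _ (by rw [← map_mul, mul_comm a, hva, map_zero])
    rw [(injective_iff_map_eq_zero _).1 hinj v this]
    exact zero_mem _
  rcases ht c with ⟨w, hw, hwc⟩ | ⟨n, w, hw, w', hw', hwc⟩
  · refine ⟨w, hw, 0, ?_⟩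
    rw [map_zero]
    apply hcancel
    rw [mul_left_comm, hf, ← map_mul, hwc, map_zero]
  have hva' := congrArg (algebraMap R S) hva
  have hwc' := congrArg (algebraMap R S) hwc
  simp only [map_mul, map_pow] at hva' hwc'
  have hu : v * v' * w ∉ p := p.primeCompl.mul_mem (p.primeCompl.mul_mem hv hv') hw
  rcases le_or_gt m n with hmn | hmn
  · obtain ⟨d, rfl⟩ := Nat.exists_eq_add_of_le hmn
    refine ⟨v * v' * w, hu, v * v * w' * t ^ d, ?_⟩
    rw [← sub_eq_zero]
    apply hcancel
    simp only [map_mul, map_pow]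
    linear_combination (algebraMap R S v * algebraMap R S v' * algebraMap R S w) * hf +
      (algebraMap R S v * algebraMap R S v') * hwc' -
      (algebraMap R S v * algebraMap R S w' * algebraMap R S t ^ d) * hva'
  -- Here `f` would have a pole along `t`. Clearing it gives an element outside `p` whose image is a
  -- multiple of `t` in `S`, which is impossible at a prime of `S` lying over `p`.
  · exfalso
    obtain ⟨d, rfl⟩ := Nat.exists_eq_add_of_lt hmn
    have h : algebraMap R S (v * v' * w * t ^ (d + 1)) * f = algebraMap R S (v * v * w') := by
      rw [← sub_eq_zero]
      apply hcancel
      simp only [map_mul, map_pow]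
      linear_combination
        (algebraMap R S v * algebraMap R S v' * algebraMap R S w * algebraMap R S t ^ (d + 1)) * hf +
        (algebraMap R S v * algebraMap R S v' * algebraMap R S t ^ (d + 1)) * hwc' -
        (algebraMap R S v * algebraMap R S w') * hva'
    obtain ⟨q, -, hq, hqp⟩ := Ideal.exists_ideal_over_prime_of_isIntegral (S := S) p ⊥ (by
      rw [← RingHom.ker_eq_comap_bot, (RingHom.injective_iff_ker_eq_bot _).mp hinj]; exact bot_le)
    have h1 : v * v * w' ∈ p := by
      rw [← hqp, Ideal.mem_comap, ← h]
      refine Ideal.mul_mem_right _ _ ?_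
      rw [← Ideal.mem_comap, hqp]
      exact Ideal.mul_mem_left _ _ (Ideal.pow_mem_of_mem _ htp _ (Nat.succ_pos d))
    exact p.primeCompl.mul_mem (p.primeCompl.mul_mem hv hv) hw' h1

theorem eq_C_mul_X_pow_of_forall_eval_ne_zero {k : Type*} [Field k] [IsAlgClosed k] (g : k[X])
    (hg : ∀ a : k, a ≠ 0 → g.eval a ≠ 0) : ∃ (c : k) (m : ℕ), c ≠ 0 ∧
      g = Polynomial.C c * Polynomial.X ^ m := by
  have hg0 : g ≠ 0 := by
    rintro rfl
    exact hg 1 one_ne_zero (by simp)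
  have hroots : g.roots = Multiset.replicate (Multiset.card g.roots) 0 := by
    rw [Multiset.eq_replicate]
    refine ⟨rfl, fun a ha => ?_⟩
    by_contra ha0
    exact hg a ha0 (Polynomial.isRoot_of_mem_roots ha)
  refine ⟨g.leadingCoeff, Multiset.card g.roots, by simpa using hg0, ?_⟩
  conv_lhs => rw [(IsAlgClosed.splits g).eq_prod_roots, hroots]
  simp

namespace IsRationalCurve

variable {k : Type*} [Field k] {s : ℕ} {A : Subalgebra k (Fin s → k[X])} {𝔪 : Ideal A}

theorem mem_pointIdeal {i : Fin s} {a : k} {f : A} : f ∈ pointIdeal A i a ↔ (f.1 i).eval a = 0 :=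
  Iff.rfl

/-- Subtracting the value at the `i`-th origin gives an element of `𝔪`, which is also the ideal of
the `j`-th origin. -/
theorem coeff_zero_eq (hA : IsRationalCurve A 𝔪) (f : Fin s → k[X]) (hf : f ∈ A) (i j : Fin s) :
    (f i).coeff 0 = (f j).coeff 0 := by
  let g : A := ⟨f, hf⟩ - algebraMap k A ((f i).coeff 0)
  have h1 : g ∈ pointIdeal A i 0 := by
    rw [mem_pointIdeal, ← Polynomial.coeff_zero_eq_eval_zero]
    change (f i - Polynomial.C ((f i).coeff 0)).coeff 0 = 0
    simp
  rw [(hA.pointIdeal_eq_iff i 0).2 rfl, ← (hA.pointIdeal_eq_iff j 0).2 rfl, mem_pointIdeal,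
    ← Polynomial.coeff_zero_eq_eval_zero] at h1
  change (f j - Polynomial.C ((f i).coeff 0)).coeff 0 = 0 at h1
  rw [Polynomial.coeff_sub, Polynomial.coeff_C_zero, sub_eq_zero] at h1
  exact h1.symm

/-- The product of local denominators for finitely many module generators of the normalization is a
conductor element outside `p`. -/
theorem exists_mem_conductor (hA : IsRationalCurve A 𝔪) (p : Ideal A) [p.IsPrime] (hp : p ≠ 𝔪) :
    ∃ u ∉ p, ∀ f : Fin s → k[X], u.1 * f ∈ A := by
  classical
  have hreg := hA.regular p hp
  have hint : Algebra.IsIntegral A (Fin s → k[X]) := ⟨hA.isNormalization.2.1⟩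
  have := krullDimLE_one_pi k s
  have hdim : Ring.KrullDimLE 1 A :=
    krullDimLE_one_of_isIntegral (S := Fin s → k[X]) Subtype.val_injective
  have h1 := IsPinched.finiteType_pi k s
  have h2 : Algebra.FiniteType A (Fin s → k[X]) :=
    Algebra.FiniteType.of_restrictScalars_finiteType k A _
  have h4 : Module.Finite A (Fin s → k[X]) := Algebra.IsIntegral.finite
  obtain ⟨G, hG⟩ := h4.1
  have hloc (f : Fin s → k[X]) : ∃ u : A, u ∉ p ∧ u.1 * f ∈ A := by
    obtain ⟨a, c, ha, hac⟩ := hA.isNormalization.2.2 f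
    obtain ⟨u, hu, g, hg⟩ := exists_mul_mem_range_of_isRegular (S := Fin s → k[X])
      Subtype.val_injective p ha hac
    exact ⟨u, hu, (show u.1 * f = g.1 from hg) ▸ g.2⟩
  choose u hup hu using hloc
  refine ⟨∏ g ∈ G, u g, ?_, fun f => ?_⟩
  · exact p.primeCompl.prod_mem fun g _ => hup g
  · have hf : f ∈ Submodule.span A (G : Set (Fin s → k[X])) := hG ▸ Submodule.mem_top
    induction hf using Submodule.span_induction with
    | mem g hg =>
      rw [← Finset.prod_erase_mul _ _ (Finset.mem_coe.1 hg)]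
      change (∏ g' ∈ G.erase g, u g').1 * (u g).1 * g ∈ A
      rw [mul_assoc]
      exact A.mul_mem (Subtype.property _) (hu g)
    | zero => simp
    | add x y _ _ hx hy => rw [mul_add]; exact A.add_mem hx hy
    | smul a x _ hx =>
      have : (∏ g ∈ G, u g).1 * a • x = a.1 * ((∏ g ∈ G, u g).1 * x) :=
        mul_left_comm _ _ _
      rw [this]
      exact A.mul_mem a.2 hx

/-- The conductor of a rational curve contains a power of the ideal of the origins. -/
theorem exists_isPinched [IsAlgClosed k] (hA : IsRationalCurve A 𝔪) : ∃ N, IsPinched N A := by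
  let c : Ideal (Fin s → k[X]) :=
    { carrier := {h | ∀ f, h * f ∈ A}
      add_mem' := fun ha hb f => by rw [add_mul]; exact A.add_mem (ha f) (hb f)
      zero_mem' := fun f => by simp
      smul_mem' := fun r x hx f => by
        rw [smul_eq_mul, mul_comm r x, mul_assoc]; exact hx _ }
  have hX (i : Fin s) : ∃ m : ℕ, Pi.single i (Polynomial.X ^ m) ∈ c := by
    let J : Ideal k[X] := c.map (Pi.evalRingHom (fun _ : Fin s => k[X]) i)
    have hsurj : Function.Surjective (Pi.evalRingHom (fun _ : Fin s => k[X]) i) := fun g =>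
      ⟨Pi.single i g, by simp⟩
    obtain ⟨g, hg⟩ := (IsPrincipalIdealRing.principal J).principal
    -- The point `x_i = a` does not lie over `𝔪`, so some conductor element does not vanish there;
    -- the generator `g` divides its `i`-th coordinate.
    have hroot (a : k) (ha : a ≠ 0) : g.eval a ≠ 0 := by
      intro h0
      have hprime : (pointIdeal A i a).IsPrime := RingHom.ker_isPrime _
      obtain ⟨u, hu, huf⟩ := hA.exists_mem_conductor (pointIdeal A i a)
        fun h => ha ((hA.pointIdeal_eq_iff i a).1 h)
      apply hu
      rw [mem_pointIdeal]
      have : u.1 i ∈ J := Ideal.mem_map_of_mem _ (show u.1 ∈ c from huf)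
      rw [hg] at this
      obtain ⟨q, hq⟩ := Ideal.mem_span_singleton'.1 this
      rw [← hq, Polynomial.eval_mul, h0, mul_zero]
    obtain ⟨b, m, hb, hgm⟩ := eq_C_mul_X_pow_of_forall_eval_ne_zero g hroot
    refine ⟨m, ?_⟩
    have hXJ : Polynomial.X ^ m ∈ J := by
      rw [hg]
      refine Ideal.mem_span_singleton'.2 ⟨Polynomial.C b⁻¹, ?_⟩
      rw [hgm, ← mul_assoc, ← Polynomial.C_mul, inv_mul_cancel₀ hb, Polynomial.C_1, one_mul]
    obtain ⟨h, hh, hhX⟩ := (Ideal.mem_map_iff_of_surjective _ hsurj).1 hXJ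
    have : Pi.single i (Polynomial.X ^ m) = h * Pi.single i 1 := by
      ext1 j
      by_cases hj : j = i
      · subst hj
        simpa using hhX.symm
      · simp [hj]
    rw [this]
    exact c.mul_mem_right _ hh
  choose m hm using hX
  -- This exponent is positive and dominates every `m i`.
  refine ⟨1 + ∑ i, m i, by omega, fun f hf => ?_, hA.coeff_zero_eq⟩
  have hsum : f = ∑ i, Pi.single i (f i) := (Finset.univ_sum_single f).symm
  rw [hsum]
  refine A.sum_mem fun i _ => ?_
  obtain ⟨q, hq⟩ := hf i
  have hle : m i ≤ 1 + ∑ i, m i :=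
    (Finset.single_le_sum (fun _ _ => Nat.zero_le _) (Finset.mem_univ i)).trans
      (Nat.le_add_left _ _)
  obtain ⟨d, hd⟩ := Nat.exists_eq_add_of_le hle
  have : (Pi.single i (f i) : Fin s → k[X]) =
      Pi.single i (Polynomial.X ^ m i) * Pi.single i (Polynomial.X ^ d * q) := by
    rw [← Pi.single_mul, hq, hd, pow_add, mul_assoc]
  rw [this]
  exact hm i _

theorem pos (hA : IsRationalCurve A 𝔪) : 0 < s := by
  rcases Nat.eq_zero_or_pos s with rfl | h
  · exfalso
    have : Subsingleton A := ⟨fun a b => Subtype.ext (Subsingleton.elim _ _)⟩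
    exact hA.isMaximal.ne_top (Subsingleton.elim _ _)
  · exact h

end IsRationalCurve

end MonomialDegeneration

/-! ### The Rees algebra in homogeneous coordinates -/

namespace MonomialDegeneration

section Substitution

variable {k : Type*} [Field k]

theorem coeff_C_mul_T {R : Type*} [Semiring R] (a : R) (n l : ℤ) :
    (LaurentPolynomial.C a * LaurentPolynomial.T n).coeff l = if n = l then a else 0 := by
  rw [← LaurentPolynomial.single_eq_C_mul_T, AddMonoidAlgebra.coeff_single, Finsupp.single_apply]

/-- The ring homomorphism `k[t][y] → k[x][T, T⁻¹]` with `t ↦ T` and `y ↦ x T ^ (-w)`. -/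
noncomputable def weightSubst (k : Type*) [Field k] (w : ℕ) : k[X][X] →+* k[X][T;T⁻¹] :=
  Polynomial.eval₂RingHom
    (Polynomial.eval₂RingHom (LaurentPolynomial.C.comp Polynomial.C) (LaurentPolynomial.T 1))
    (LaurentPolynomial.C Polynomial.X * LaurentPolynomial.T (-w))

theorem weightSubst_monomial (w m j : ℕ) (c : k) :
    weightSubst k w (Polynomial.monomial m (Polynomial.monomial j c)) =
      LaurentPolynomial.C (Polynomial.monomial m c) * LaurentPolynomial.T (j - w * m) := by
  simp only [weightSubst, Polynomial.coe_eval₂RingHom, Polynomial.eval₂_monomial,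
    RingHom.comp_apply, LaurentPolynomial.T_pow, mul_pow, ← map_pow]
  rw [← Polynomial.C_mul_X_pow_eq_monomial, map_mul, sub_eq_add_neg, LaurentPolynomial.T_add,
    mul_one, mul_mul_mul_comm]
  congr 3
  ring

/-- The monomial `t ^ j y ^ m` goes to `x ^ m T ^ (j - w m)`, so `x ^ m T ^ n` can only come from `j
= n + w m`. -/
theorem coeff_weightSubst (w : ℕ) (g : k[X][X]) (n : ℤ) (m : ℕ) :
    ((weightSubst k w g).coeff n).coeff m =
      if 0 ≤ n + w * m then (g.coeff m).coeff (n + w * m).toNat else 0 := by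
  induction g using Polynomial.induction_on' with
  | add p q hp hq =>
    rw [map_add, AddMonoidAlgebra.coeff_add, Finsupp.add_apply, Polynomial.coeff_add, hp, hq]
    split_ifs <;> simp
  | monomial l a =>
    induction a using Polynomial.induction_on' with
    | add p q hp hq =>
      rw [map_add, map_add, AddMonoidAlgebra.coeff_add, Finsupp.add_apply, Polynomial.coeff_add,
        hp, hq]
      split_ifs <;> simp
    | monomial j c =>
      rw [weightSubst_monomial, coeff_C_mul_T, Polynomial.coeff_monomial]
      by_cases hl : l = m
      · subst hl
        rw [if_pos rfl, Polynomial.coeff_monomial]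
        by_cases hj : (j : ℤ) - w * l = n
        · rw [if_pos hj, if_pos (by omega), if_pos (by omega), Polynomial.coeff_monomial, if_pos rfl]
        · rw [if_neg hj, Polynomial.coeff_zero]
          split_ifs with h1 h2
          · omega
          · rfl
          · rfl
      · rw [if_neg hl, Polynomial.coeff_zero]
        split_ifs <;> simp [Polynomial.coeff_monomial, hl]

theorem weightSubst_injective (w : ℕ) : Function.Injective (weightSubst k w) := by
  intro g h hgh
  ext m j
  have := congrArg (fun q => (q.coeff ((j : ℤ) - w * m)).coeff m) hgh
  simpa [coeff_weightSubst] using this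

/-- The inequality on exponents is the Rees condition in one coordinate: a coefficient of `T ^ (-n)`
has weight at least `n`. -/
theorem exists_weightSubst_eq (w : ℕ) (q : k[X][T;T⁻¹])
    (hq : ∀ (n : ℤ) (m : ℕ), (q.coeff n).coeff m ≠ 0 → 0 ≤ n + w * m) :
    ∃ g, weightSubst k w g = q := by
  refine ⟨∑ n ∈ q.coeff.support, ∑ m ∈ (q.coeff n).support,
    Polynomial.monomial m (Polynomial.monomial (n + w * m).toNat ((q.coeff n).coeff m)), ?_⟩
  rw [map_sum]
  conv_rhs => rw [← AddMonoidAlgebra.sum_coeff_single q, Finsupp.sum]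
  refine Finset.sum_congr rfl fun n _ => ?_
  rw [map_sum, LaurentPolynomial.single_eq_C_mul_T]
  conv_rhs => rw [(q.coeff n).as_sum_support, map_sum, Finset.sum_mul]
  refine Finset.sum_congr rfl fun m hm => ?_
  rw [weightSubst_monomial]
  congr 2
  have := hq n m (Polynomial.mem_support_iff.1 hm)
  omega

end Substitution

section Model

variable {k : Type*} [Field k] {s : ℕ} (A : Subalgebra k (Fin s → k[X])) (w : Fin s → ℕ)

/-- The `i`-th coordinate of a Laurent polynomial over `A ⊆ ∏ k[x_i]`. -/
noncomputable def laurentCoord (i : Fin s) : A[T;T⁻¹] →+* k[X][T;T⁻¹] :=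
  AddMonoidAlgebra.mapRingHom ℤ (IsPinched.coord A i).toRingHom

variable {A} in
theorem coeff_laurentCoord (i : Fin s) (p : A[T;T⁻¹]) (n : ℤ) :
    (laurentCoord A i p).coeff n = (p.coeff n).1 i := by
  simp [laurentCoord, IsPinched.coord]

variable {A} in
theorem laurentCoord_C_mul_T (i : Fin s) (a : A) (n : ℤ) :
    laurentCoord A i (LaurentPolynomial.C a * LaurentPolynomial.T n) =
      LaurentPolynomial.C (a.1 i) * LaurentPolynomial.T n := by
  ext l
  rw [coeff_laurentCoord, coeff_C_mul_T, coeff_C_mul_T]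
  split_ifs <;> rfl

variable {A} in
theorem laurentCoord_ext {p q : A[T;T⁻¹]} (h : ∀ i, laurentCoord A i p = laurentCoord A i q) :
    p = q := by
  ext1 n
  ext1
  ext1 i
  rw [← coeff_laurentCoord, ← coeff_laurentCoord, h]

theorem weightSubst_C (v : ℕ) (q : k[X]) (i : Fin s) : weightSubst k v (Polynomial.C q) =
    laurentCoord A i (Polynomial.aeval (LaurentPolynomial.T 1 : A[T;T⁻¹]) q) := by
  induction q using Polynomial.induction_on' with
  | add p q hp hq => simp only [map_add, hp, hq]
  | monomial n c =>
    have h : Polynomial.aeval (LaurentPolynomial.T 1 : A[T;T⁻¹]) (Polynomial.monomial n c) =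
        LaurentPolynomial.C (algebraMap k A c) * LaurentPolynomial.T n := by
      rw [Polynomial.aeval_monomial, LaurentPolynomial.T_pow, mul_one]
      rfl
    rw [h, laurentCoord_C_mul_T, ← Polynomial.monomial_zero_left, weightSubst_monomial]
    simp

/-- The extended Rees algebra of `A`, in terms of the parameter `t` and the homogeneous coordinates
`y_i = x_i t ^ (-w_i)`, as a subalgebra of `∏ k[t][y_i]`. -/
def reesModel : Subalgebra k[X] (Fin s → k[X][X]) where
  carrier := {g | ∃ p : A[T;T⁻¹], ∀ i, laurentCoord A i p = weightSubst k (w i) (g i)}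
  mul_mem' := by
    rintro g h ⟨p, hp⟩ ⟨q, hq⟩
    exact ⟨p * q, fun i => by rw [map_mul, hp, hq, ← map_mul]; rfl⟩
  add_mem' := by
    rintro g h ⟨p, hp⟩ ⟨q, hq⟩
    exact ⟨p + q, fun i => by rw [map_add, hp, hq, ← map_add]; rfl⟩
  algebraMap_mem' q := ⟨Polynomial.aeval (LaurentPolynomial.T 1 : A[T;T⁻¹]) q, fun i =>
    (weightSubst_C A (w i) q i).symm⟩

variable {A w}

/-- Membership in `A[T;T⁻¹]` is tested separately on each power of `T`. -/
theorem mem_reesModel_iff {g : Fin s → k[X][X]} : g ∈ reesModel A w ↔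
    ∀ n : ℤ, (fun i => (weightSubst k (w i) (g i)).coeff n) ∈ A := by
  constructor
  · rintro ⟨p, hp⟩ n
    convert! (p.coeff n).2 using 1
    ext1 i
    rw [← hp, coeff_laurentCoord]
  · intro h
    classical
    let U : Finset ℤ := Finset.univ.biUnion fun i => (weightSubst k (w i) (g i)).coeff.support
    refine ⟨∑ n ∈ U, AddMonoidAlgebra.single n ⟨_, h n⟩, fun i => ?_⟩
    rw [map_sum]
    simp only [LaurentPolynomial.single_eq_C_mul_T, laurentCoord_C_mul_T]
    simp only [← LaurentPolynomial.single_eq_C_mul_T]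
    conv_rhs => rw [← AddMonoidAlgebra.sum_coeff_single (weightSubst k (w i) (g i))]
    symm
    refine Finset.sum_subset (Finset.subset_biUnion_of_mem
      (fun i => (weightSubst k (w i) (g i)).coeff.support) (Finset.mem_univ i)) fun n _ hn => ?_
    rw [Finsupp.notMem_support_iff.1 hn, AddMonoidAlgebra.single_zero]

theorem mem_reesAlgebra_iff {p : A[T;T⁻¹]} : p ∈ reesAlgebra (weightFiltration A w) ↔
    ∃ g : Fin s → k[X][X], ∀ i, weightSubst k (w i) (g i) = laurentCoord A i p := by
  constructor
  · intro hp
    have hex (i : Fin s) : ∃ g, weightSubst k (w i) g = laurentCoord A i p := by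
      refine exists_weightSubst_eq (w i) _ fun n m h => ?_
      rw [coeff_laurentCoord] at h
      have := hp (-n)
      rw [neg_neg] at this
      have := this i m h
      omega
    choose g hg using hex
    exact ⟨g, hg⟩
  · rintro ⟨g, hg⟩ n i m h
    rw [← coeff_laurentCoord, ← hg, coeff_weightSubst] at h
    have := (ite_ne_right_iff.1 h).1
    omega

theorem exists_reesEquiv (A : Subalgebra k (Fin s → k[X])) (w : Fin s → ℕ) :
    ∃ e : reesAlgebra (weightFiltration A w) ≃+* reesModel A w,
    (∀ r i, weightSubst k (w i) ((e r).1 i) = laurentCoord A i r.1) ∧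
    ∀ q, e (reesParameter (weightFiltration A w) q) = algebraMap k[X] (reesModel A w) q := by
  choose f hf using fun r : reesAlgebra (weightFiltration A w) => mem_reesAlgebra_iff.1 r.2
  let e : reesAlgebra (weightFiltration A w) →+* reesModel A w :=
    { toFun r := ⟨f r, r.1, fun i => (hf r i).symm⟩
      map_one' := by
        ext1; ext1 i
        apply weightSubst_injective (w i)
        simp [hf]
      map_mul' a b := by
        ext1; ext1 i
        apply weightSubst_injective (w i)
        simp [hf]
      map_zero' := by
        ext1; ext1 i
        apply weightSubst_injective (w i)
        simp [hf]
      map_add' a b := by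
        ext1; ext1 i
        apply weightSubst_injective (w i)
        simp [hf] }
  have he (r) (i) : weightSubst k (w i) ((e r).1 i) = laurentCoord A i r.1 := hf r i
  have hbij : Function.Bijective e := by
    constructor
    · intro a b hab
      ext1
      refine laurentCoord_ext fun i => ?_
      rw [← he, ← he, hab]
    · rintro ⟨g, p, hp⟩
      refine ⟨⟨p, mem_reesAlgebra_iff.2 ⟨g, fun i => (hp i).symm⟩⟩, ?_⟩
      ext1; ext1 i
      apply weightSubst_injective (w i)
      rw [he, ← hp]
  refine ⟨RingEquiv.ofBijective e hbij, he, fun q => ?_⟩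
  ext1; ext1 i
  apply weightSubst_injective (w i)
  refine (he _ i).trans ?_
  refine Eq.trans ?_ (weightSubst_C A (w i) q i).symm
  congr 1
  exact (Polynomial.aeval_algHom_apply (reesAlgebra (weightFiltration A w)).val
    ⟨LaurentPolynomial.T 1, T_mem_reesAlgebra _⟩ q).symm

/-- The substitution turns the degree in `y_i` into the degree in `x_i`, so both conditions pass to
each coefficient of `T ^ n`, where they hold for `A`. -/
theorem isPinched_reesModel {N : ℕ} (hA : IsPinched N A) : IsPinched N (reesModel A w) where
  pos := hA.pos
  mem_of_dvd g hg := by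
    rw [mem_reesModel_iff]
    intro n
    refine hA.mem_of_dvd _ fun i => ?_
    rw [Polynomial.X_pow_dvd_iff]
    intro m hm
    rw [coeff_weightSubst, Polynomial.X_pow_dvd_iff.1 (hg i) m hm]
    simp
  coeff_zero_eq g hg i j := by
    ext n
    have := hA.coeff_zero_eq _ (mem_reesModel_iff.1 hg n) i j
    simpa [coeff_weightSubst] using this

/-- If `a n` is the coefficient of `T ^ n` in `h`, the hypothesis says `a (n - 1) - b • a n ∈ A`. As
`a n` vanishes for large `n`, descending induction puts every `a n` in `A`. -/
theorem mem_reesModel_of_sub_smul_mem (b : k) {h : Fin s → k[X][X]}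
    (hh : (Polynomial.X - Polynomial.C b) • h ∈ reesModel A w) : h ∈ reesModel A w := by
  classical
  rw [mem_reesModel_iff] at hh ⊢
  let a (n : ℤ) : Fin s → k[X] := fun i => (weightSubst k (w i) (h i)).coeff n
  have hstep (n : ℤ) : a (n - 1) - b • a n ∈ A := by
    convert! hh n using 1
    ext1 i
    ext1 m
    simp only [a, Pi.sub_apply, Pi.smul_apply, Polynomial.coeff_sub, Polynomial.coeff_smul,
      coeff_weightSubst, smul_eq_mul, Polynomial.coeff_C_mul, sub_mul]
    by_cases h0 : 0 ≤ n + w i * m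
    · rw [if_pos h0, if_pos h0]
      by_cases h1 : 0 ≤ n - 1 + w i * m
      · rw [if_pos h1]
        obtain ⟨l, hl⟩ : ∃ l : ℕ, (n + w i * m).toNat = l + 1 ∧ (n - 1 + w i * m).toNat = l :=
          ⟨(n - 1 + w i * m).toNat, by omega, rfl⟩
        rw [hl.1, hl.2, Polynomial.coeff_X_mul]
      · rw [if_neg h1]
        have : (n + w i * m).toNat = 0 := by omega
        rw [this]
        simp
    · rw [if_neg h0, if_neg h0, if_neg (by omega)]
      simp
  obtain ⟨n₀, hn₀⟩ : ∃ n₀ : ℤ, ∀ n, n₀ ≤ n → a n = 0 := by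
    have hex (i : Fin s) : ∃ n₀ : ℤ, ∀ n, n₀ ≤ n → (weightSubst k (w i) (h i)).coeff n = 0 := by
      obtain ⟨M, hM⟩ := (weightSubst k (w i) (h i)).coeff.support.bddAbove
      refine ⟨M + 1, fun n hn => Finsupp.notMem_support_iff.1 fun hmem => ?_⟩
      have := hM hmem
      omega
    choose n₀ hn₀ using hex
    obtain ⟨M, hM⟩ := (Finset.univ.image n₀).bddAbove
    refine ⟨M, fun n hn => funext fun i => hn₀ i n ((hM ?_).trans hn)⟩
    simp
  have hind (d : ℕ) : a (n₀ - d) ∈ A := by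
    induction d with
    | zero => rw [hn₀ _ (by simp)]; exact A.zero_mem
    | succ d ih =>
      have := A.add_mem (hstep (n₀ - d)) (A.smul_mem ih b)
      rw [sub_add_cancel] at this
      convert! this using 2
      push_cast
      ring
  intro n
  rcases le_total n₀ n with hn | hn
  · change a n ∈ A
    rw [hn₀ n hn]; exact A.zero_mem
  · have := hind (n₀ - n).toNat
    rwa [Int.toNat_of_nonneg (by omega), sub_sub_cancel] at this

end Model

end MonomialDegeneration

/-! ### Fibres: specialization, rescaling, initial monomials, constancy of `δ` -/

namespace MonomialDegeneration

variable {k : Type*} [Field k] {s : ℕ}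

/-- Specialization `t = b` from `∏ k[t][y_i]` to `∏ k[y_i]`. -/
noncomputable def specialize (k : Type*) [Field k] (s : ℕ) (b : k) :
    (Fin s → k[X][X]) →+* (Fin s → k[X]) :=
  RingHom.pi fun i => (Polynomial.mapRingHom (Polynomial.evalRingHom b)).comp
    (Pi.evalRingHom (fun _ : Fin s => k[X][X]) i)

theorem specialize_apply (b : k) (g : Fin s → k[X][X]) (i : Fin s) :
    specialize k s b g i = (g i).map (Polynomial.evalRingHom b) := rfl

theorem specialize_algebraMap (b : k) (q : k[X]) :
    specialize k s b (algebraMap k[X] (Fin s → k[X][X]) q) =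
      algebraMap k (Fin s → k[X]) (q.eval b) := by
  ext1 i
  rw [specialize_apply]
  exact Polynomial.map_C _

theorem specialize_map_C (b : k) (f : Fin s → k[X]) :
    specialize k s b (fun i => (f i).map Polynomial.C) = f := by
  ext1 i
  rw [specialize_apply, Polynomial.map_map]
  have : (Polynomial.evalRingHom b).comp Polynomial.C = RingHom.id k := by ext; simp
  rw [this, Polynomial.map_id]

theorem exists_eq_smul_of_specialize_eq_zero {b : k} {g : Fin s → k[X][X]}
    (hg : specialize k s b g = 0) : ∃ h, g = (Polynomial.X - Polynomial.C b) • h := by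
  have hdvd (i : Fin s) : Polynomial.C (Polynomial.X - Polynomial.C b) ∣ g i := by
    rw [Polynomial.C_dvd_iff_dvd_coeff]
    intro m
    rw [Polynomial.dvd_iff_isRoot]
    have := congrArg (fun f => (f i).coeff m) hg
    simpa [specialize_apply] using this
  choose h hh using hdvd
  exact ⟨h, funext fun i => by rw [hh i, Pi.smul_apply, Polynomial.smul_eq_C_mul]⟩

section Fibre

variable (A : Subalgebra k (Fin s → k[X])) (w : Fin s → ℕ)

/-- The coordinate ring of the fibre of the Rees degeneration over `t = b`. -/
noncomputable def reesFibre (b : k) : Subalgebra k (Fin s → k[X]) where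
  __ := (reesModel A w).toSubring.map (specialize k s b)
  algebraMap_mem' c := ⟨algebraMap k[X] _ (Polynomial.C c),
    (reesModel A w).algebraMap_mem _, by
      rw [specialize_algebraMap, Polynomial.eval_C]⟩

variable {A w}

theorem isPinched_reesFibre {N : ℕ} (hA : IsPinched N A) (b : k) :
    IsPinched N (reesFibre A w b) where
  pos := hA.pos
  mem_of_dvd f hf := by
    refine ⟨fun i => (f i).map Polynomial.C, ?_, specialize_map_C b f⟩
    refine (isPinched_reesModel hA).mem_of_dvd _ fun i => ?_
    simpa using Polynomial.map_dvd Polynomial.C (hf i)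
  coeff_zero_eq f hf i j := by
    obtain ⟨g, hg, rfl⟩ := hf
    rw [specialize_apply, specialize_apply, Polynomial.coeff_map, Polynomial.coeff_map,
      (isPinched_reesModel hA).coeff_zero_eq g hg i j]

variable (A w) in
/-- The restriction of functions to the fibre over `t = b`. -/
noncomputable def toReesFibre (b : k) : reesModel A w →+* reesFibre A w b :=
  ((specialize k s b).comp (reesModel A w).val.toRingHom).codRestrict (reesFibre A w b)
    fun g => ⟨g.1, g.2, rfl⟩

theorem toReesFibre_coe (b : k) (g : reesModel A w) :
    (toReesFibre A w b g).1 = specialize k s b g.1 := rfl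

theorem toReesFibre_surjective (b : k) : Function.Surjective (toReesFibre A w b) := by
  rintro ⟨f, g, hg, rfl⟩
  exact ⟨⟨g, hg⟩, rfl⟩

theorem toReesFibre_algebraMap (b : k) (q : k[X]) :
    toReesFibre A w b (algebraMap k[X] (reesModel A w) q) =
      algebraMap k (reesFibre A w b) (q.eval b) :=
  Subtype.ext (specialize_algebraMap b q)

/-- Saturation of the model identifies its quotient by `t - b` with the specialized subalgebra. -/
theorem ker_toReesFibre (b : k) : RingHom.ker (toReesFibre A w b) =
    Ideal.span {algebraMap k[X] (reesModel A w) (Polynomial.X - Polynomial.C b)} := by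
  ext g
  rw [RingHom.mem_ker, Ideal.mem_span_singleton']
  constructor
  · intro hg
    obtain ⟨h, hh⟩ := exists_eq_smul_of_specialize_eq_zero
      (show specialize k s b g.1 = 0 from congrArg Subtype.val hg)
    have hmem : h ∈ reesModel A w := mem_reesModel_of_sub_smul_mem b (hh ▸ g.2)
    refine ⟨⟨h, hmem⟩, ?_⟩
    ext1
    rw [hh, mul_comm, Algebra.smul_def]
    rfl
  · rintro ⟨h, rfl⟩
    rw [map_mul, toReesFibre_algebraMap]
    simp

/-- Evaluation of Laurent polynomials over `k[x]` at `T = b`, followed by `x ↦ b ^ v x`. -/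
noncomputable def laurentScale (b : kˣ) (v : ℕ) : k[X][T;T⁻¹] →+* k[X] :=
  LaurentPolynomial.eval₂
    (Polynomial.compRingHom (Polynomial.C ((b : k) ^ v) * Polynomial.X))
    (Units.map Polynomial.C.toMonoidHom b)

/-- At `T = b` the coordinate `y = x T ^ (-v)` becomes `b ^ (-v) x`, and the scaling `x ↦ b ^ v x`
undoes this factor. -/
theorem laurentScale_weightSubst (b : kˣ) (v : ℕ) (g : k[X][X]) :
    laurentScale b v (weightSubst k v g) = g.map (Polynomial.evalRingHom (b : k)) := by
  have : (laurentScale b v).comp (weightSubst k v) =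
      Polynomial.mapRingHom (Polynomial.evalRingHom (b : k)) := by
    have hT (n : ℤ) : laurentScale b v (LaurentPolynomial.T n) =
        Polynomial.C (((b ^ n : kˣ) : k)) := by
      rw [laurentScale, LaurentPolynomial.eval₂_T, ← map_zpow]
      rfl
    have hC (f : k[X]) : laurentScale b v (LaurentPolynomial.C f) =
        f.comp (Polynomial.C ((b : k) ^ v) * Polynomial.X) := by
      rw [laurentScale, LaurentPolynomial.eval₂_C]
      rfl
    ext
    · simp [weightSubst, hC]
    · simp [weightSubst, hT]
    · have h1 : weightSubst k v Polynomial.X =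
          LaurentPolynomial.C Polynomial.X * LaurentPolynomial.T (-v) := by
        simp [weightSubst]
      have h2 : (b : k) ^ v * ((b ^ (-(v : ℤ)) : kˣ) : k) = 1 := by
        rw [← Units.val_pow_eq_pow_val, ← Units.val_mul, zpow_neg, zpow_natCast, mul_inv_cancel,
          Units.val_one]
      rw [RingHom.comp_apply, h1, map_mul, hC, hT, Polynomial.X_comp, mul_right_comm,
        ← Polynomial.C_mul, h2]
      simp
  exact congrArg (fun φ : k[X][X] →+* k[X] => φ g) this

variable (A) in
/-- Evaluation of Laurent polynomials over `A` at `T = b`. -/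
noncomputable def laurentEval (b : kˣ) : A[T;T⁻¹] →+* A :=
  LaurentPolynomial.eval₂ (RingHom.id A) (Units.map (algebraMap k A).toMonoidHom b)

theorem laurentScale_laurentCoord (b : kˣ) (v : ℕ) (i : Fin s) (p : A[T;T⁻¹]) :
    laurentScale b v (laurentCoord A i p) =
      ((laurentEval A b p).1 i).comp (Polynomial.C ((b : k) ^ v) * Polynomial.X) := by
  induction p using LaurentPolynomial.induction_on' with
  | add p q hp hq =>
    rw [map_add, map_add, map_add, hp, hq, ← Polynomial.add_comp]
    rfl
  | C_mul_T n a =>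
    rw [laurentCoord_C_mul_T, laurentScale, laurentEval, LaurentPolynomial.eval₂_C_mul_T,
      LaurentPolynomial.eval₂_C_mul_T, ← map_zpow, ← map_zpow]
    change _ = (a.1 i * Polynomial.C ((b ^ n : kˣ) : k)).comp _
    rw [Polynomial.mul_comp, Polynomial.C_comp]
    rfl

theorem specialize_eq_of_laurentCoord (b : kˣ) {g : Fin s → k[X][X]} {p : A[T;T⁻¹]}
    (hp : ∀ i, laurentCoord A i p = weightSubst k (w i) (g i)) (i : Fin s) :
    specialize k s (b : k) g i =
      ((laurentEval A b p).1 i).comp (Polynomial.C ((b : k) ^ w i) * Polynomial.X) := by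
  rw [specialize_apply, ← laurentScale_weightSubst b (w i), ← hp, laurentScale_laurentCoord]

/-- The rescaling `x_i ↦ b ^ w_i x_i` of `∏ k[x_i]`. -/
noncomputable def rescale (w : Fin s → ℕ) (b : k) : (Fin s → k[X]) →ₐ[k] (Fin s → k[X]) :=
  AlgHom.pi fun i => (Polynomial.aeval (Polynomial.C (b ^ w i) * Polynomial.X : k[X])).comp
    (Pi.evalAlgHom k (fun _ : Fin s => k[X]) i)

theorem rescale_apply (b : k) (f : Fin s → k[X]) (i : Fin s) :
    rescale w b f i = (f i).comp (Polynomial.C (b ^ w i) * Polynomial.X) := rfl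

theorem rescale_injective {b : k} (hb : b ≠ 0) : Function.Injective (rescale (s := s) w b) := by
  intro f g hfg
  ext i m
  have := congrArg (fun f => (f i).coeff m) hfg
  simp only [rescale_apply, Polynomial.comp_C_mul_X_coeff] at this
  exact mul_right_cancel₀ (pow_ne_zero m (pow_ne_zero (w i) hb)) this

/-- Away from `t = 0` the fibres of the Rees degeneration are isomorphic to `Spec A`. -/
theorem exists_algEquiv_reesFibre {b : k} (hb : b ≠ 0) : Nonempty (A ≃ₐ[k] reesFibre A w b) := by
  let u : kˣ := Units.mk0 b hb
  have hmem (f : A) : rescale w b f.1 ∈ reesFibre A w b := by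
    obtain ⟨g, hg⟩ := mem_reesAlgebra_iff (w := w).1 (show LaurentPolynomial.C f ∈
        reesAlgebra (weightFiltration A w) by
      intro n
      rw [LaurentPolynomial.C_apply]
      split_ifs with h
      · rw [(weightFiltration A w).step_nonpos n (by omega)]; exact Submodule.mem_top
      · exact Submodule.zero_mem _)
    refine ⟨g, ⟨_, fun i => (hg i).symm⟩, ?_⟩
    ext1 i
    refine (specialize_eq_of_laurentCoord u (fun i => (hg i).symm) i).trans ?_
    rw [laurentEval, LaurentPolynomial.eval₂_C]
    rfl
  refine ⟨AlgEquiv.ofBijective (((rescale w b).comp A.val).codRestrict _ hmem) ⟨?_, ?_⟩⟩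
  · intro f g hfg
    exact Subtype.ext (rescale_injective hb (congrArg Subtype.val hfg))
  · rintro ⟨f, g, ⟨p, hp⟩, rfl⟩
    refine ⟨laurentEval A u p, ?_⟩
    ext1; ext1 i
    exact (specialize_eq_of_laurentCoord u hp i).symm

/-- Setting `t = 0` keeps exactly the terms whose weight equals the filtration degree, that is, the
initial forms. -/
theorem coeff_specialize_zero (g : Fin s → k[X][X]) (i : Fin s) (m : ℕ) :
    (specialize k s 0 g i).coeff m =
      ((weightSubst k (w i) (g i)).coeff (-((w i : ℤ) * m))).coeff m := by
  rw [specialize_apply, Polynomial.coeff_map, coeff_weightSubst]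
  simp [Polynomial.coeff_zero_eq_eval_zero]

/-- Every monomial occurring in an element of the special fibre belongs to the special fibre, if
distinct monomials of exponents less than `N` have distinct weights. -/
theorem single_mem_reesFibre_zero {N : ℕ} (hA : IsPinched N A)
    (hw : ∀ i j, i ≠ j → ∀ l m, 0 < m → m < N → l < N → w i * m ≠ w j * l)
    (hpos : ∀ i, 0 < w i)
    {f : Fin s → k[X]} (hf : f ∈ reesFibre A w 0) {i : Fin s} {m : ℕ} (hm : 0 < m)
    (hfm : (f i).coeff m ≠ 0) : Pi.single i (Polynomial.X ^ m) ∈ reesFibre A w 0 := by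
  have hB := isPinched_reesFibre (w := w) hA 0
  rcases le_or_gt N m with hNm | hmN
  · refine hB.mem_of_dvd _ fun j => ?_
    by_cases hj : j = i
    · subst hj; simpa using pow_dvd_pow _ hNm
    · simp [hj]
  obtain ⟨g, hg, rfl⟩ := hf
  rw [coeff_specialize_zero (w := w)] at hfm
  -- This is the homogeneous component of `g` of weight `w i * m`; it lies in that step of the
  -- filtration, so it may be replaced by the single Rees element `a T ^ (-w_i m)`.
  let a : A := ⟨_, mem_reesModel_iff.1 hg (-((w i : ℤ) * m))⟩
  have ha (j : Fin s) (l : ℕ) (h : (a.1 j).coeff l ≠ 0) : (w i : ℤ) * m ≤ w j * l := by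
    have h' : ((weightSubst k (w j) (g j)).coeff (-((w i : ℤ) * m))).coeff l ≠ 0 := h
    rw [coeff_weightSubst] at h'
    have := (ite_ne_right_iff.1 h').1
    omega
  obtain ⟨g', hg'⟩ := mem_reesAlgebra_iff (w := w).1
    (show LaurentPolynomial.C a * LaurentPolynomial.T (-((w i : ℤ) * m)) ∈
        reesAlgebra (weightFiltration A w) by
      intro n
      rw [coeff_C_mul_T]
      split_ifs with h
      · intro j l hl
        have := ha j l hl
        omega
      · exact Submodule.zero_mem _)
  have hf' : specialize k s 0 g' ∈ reesFibre A w 0 := ⟨g', ⟨_, fun i => (hg' i).symm⟩, rfl⟩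
  have hcoeff (j : Fin s) (l : ℕ) : (specialize k s 0 g' j).coeff l =
      if (w i : ℤ) * m = w j * l then (a.1 j).coeff l else 0 := by
    rw [coeff_specialize_zero (w := w), hg', laurentCoord_C_mul_T, coeff_C_mul_T]
    by_cases h : (w i : ℤ) * m = w j * l
    · rw [if_pos (by omega), if_pos h]
    · rw [if_neg (by omega), if_neg h, Polynomial.coeff_zero]
  set c := (a.1 i).coeff m with hc
  -- Below degree `N` the only monomial of weight `w i * m` is `x_i ^ m`; the remaining terms are
  -- divisible by `X ^ N`.
  have hdiff : specialize k s 0 g' - c • (Pi.single i (Polynomial.X ^ m) : Fin s → k[X]) ∈ reesFibre A w 0 := by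
    refine hB.mem_of_dvd _ fun j => ?_
    rw [Polynomial.X_pow_dvd_iff]
    intro l hl
    rw [Pi.sub_apply, Pi.smul_apply, Polynomial.coeff_sub, hcoeff, Polynomial.coeff_smul]
    by_cases hj : j = i
    · subst hj
      rw [Pi.single_eq_same, Polynomial.coeff_X_pow]
      by_cases hlm : l = m
      · subst hlm; simp [hc]
      · rw [if_neg, if_neg hlm]
        · simp
        · intro h
          have h' : w j * m = w j * l := by exact_mod_cast h
          exact hlm (Nat.eq_of_mul_eq_mul_left (hpos j) h').symm
    · rw [if_neg, Pi.single_eq_of_ne hj]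
      · simp
      · intro h
        exact hw i j (Ne.symm hj) l m hm hmN hl (by exact_mod_cast h)
  have h1 := (reesFibre A w 0).sub_mem hf' hdiff
  rw [sub_sub_cancel] at h1
  have h2 := (reesFibre A w 0).smul_mem h1 c⁻¹
  rwa [smul_smul, inv_mul_cancel₀ (show c ≠ 0 from hfm), one_smul] at h2

theorem isMonomialSubring_reesFibre_zero {N : ℕ} (hA : IsPinched N A) (i₀ : Fin s)
    (hw : ∀ i j, i ≠ j → ∀ l m, 0 < m → m < N → l < N → w i * m ≠ w j * l)
    (hpos : ∀ i, 0 < w i) : IsMonomialSubring (reesFibre A w 0) := by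
  have hB := isPinched_reesFibre (w := w) hA 0
  let M : Set (Fin s × ℕ) :=
    {x | 0 < x.2 ∧ Pi.single x.1 (Polynomial.X ^ x.2) ∈ reesFibre A w 0}
  refine ⟨M, fun x hx => hx.1, le_antisymm ?_ ?_⟩
  · intro f hf
    set D := Algebra.adjoin k
      ((fun x : Fin s × ℕ => (Pi.single x.1 (Polynomial.X ^ x.2) : Fin s → k[X])) '' M)
    have hfeq : f = algebraMap k (Fin s → k[X]) ((f i₀).coeff 0) +
        ∑ i, ∑ m ∈ (f i).support.erase 0, (f i).coeff m • Pi.single i (Polynomial.X ^ m) := by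
      ext1 j
      rw [Pi.add_apply, Finset.sum_apply, Finset.sum_eq_single j]
      · have h0 : (algebraMap k (Fin s → k[X]) ((f i₀).coeff 0)) j =
            Polynomial.C ((f j).coeff 0) := by
          rw [hB.coeff_zero_eq f hf j i₀]; rfl
        rw [h0, Finset.sum_apply]
        simp only [Pi.smul_apply, Pi.single_eq_same, Polynomial.smul_eq_C_mul]
        conv_lhs => rw [(f j).as_sum_support_C_mul_X_pow]
        by_cases h : 0 ∈ (f j).support
        · rw [← Finset.add_sum_erase _ _ h]
          simp
        · rw [Finset.erase_eq_of_notMem h, Polynomial.notMem_support_iff.1 h]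
          simp
      · intro i _ hij
        rw [Finset.sum_apply]
        refine Finset.sum_eq_zero fun m _ => ?_
        rw [Pi.smul_apply, Pi.single_eq_of_ne hij.symm, smul_zero]
      · simp
    rw [hfeq]
    refine D.add_mem (D.algebraMap_mem _) (D.sum_mem fun i _ => D.sum_mem fun m hm => ?_)
    rw [Finset.mem_erase, Polynomial.mem_support_iff] at hm
    refine D.smul_mem (Algebra.subset_adjoin ⟨(i, m), ⟨Nat.pos_of_ne_zero hm.1, ?_⟩, rfl⟩) _
    exact single_mem_reesFibre_zero hA hw hpos hf (Nat.pos_of_ne_zero hm.1) hm.2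
  · rw [Algebra.adjoin_le_iff]
    rintro _ ⟨x, hx, rfl⟩
    exact hx.2

/-- For `i < j`, a positive multiple of `(N + 1) ^ j` exceeds any multiple of `(N + 1) ^ i` by a
factor below `N`. -/
theorem pow_mul_ne_pow_mul {N : ℕ} {i j : ℕ} (hij : i ≠ j) {l m : ℕ} (hm : 0 < m) (hmN : m < N)
    (hl : l < N) : (N + 1) ^ i * m ≠ (N + 1) ^ j * l := by
  have key {i j l m : ℕ} (hij : i < j) (hl : 0 < l) (hm : m < N) :
      (N + 1) ^ i * m < (N + 1) ^ j * l := by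
    calc (N + 1) ^ i * m < (N + 1) ^ i * (N + 1) := by
          exact Nat.mul_lt_mul_of_pos_left (by omega) (by positivity)
      _ = (N + 1) ^ (i + 1) := (pow_succ _ _).symm
      _ ≤ (N + 1) ^ j := Nat.pow_le_pow_right (by omega) hij
      _ ≤ (N + 1) ^ j * l := Nat.le_mul_of_pos_right _ hl
  rcases Nat.lt_or_gt_of_ne hij with h | h
  · rcases Nat.eq_zero_or_pos l with rfl | hl0
    · simp [hm.ne']
    · exact (key h hl0 hmN).ne
  · exact (key h hm hl).ne'

/-- Over an algebraically closed field `q` is a constant times linear factors, which are removed one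
at a time; hence the quotient by the model is torsion-free over `k[t]`. -/
theorem mem_reesModel_of_smul_mem [IsAlgClosed k] {q : k[X]} (hq : q ≠ 0) {h : Fin s → k[X][X]}
    (hh : q • h ∈ reesModel A w) : h ∈ reesModel A w := by
  induction hn : q.natDegree generalizing q with
  | zero =>
    rw [Polynomial.eq_C_of_natDegree_eq_zero hn] at hh hq
    have hc : q.coeff 0 ≠ 0 := by simpa using hq
    have := (reesModel A w).smul_mem hh (Polynomial.C (q.coeff 0)⁻¹)
    rwa [smul_smul, ← Polynomial.C_mul, inv_mul_cancel₀ hc, Polynomial.C_1, one_smul] at this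
  | succ n ih =>
    obtain ⟨b, hb⟩ := IsAlgClosed.exists_root q (by
      intro h0
      have : q.natDegree = 0 := Polynomial.natDegree_eq_of_degree_eq_some h0
      omega)
    obtain ⟨q', rfl⟩ := Polynomial.dvd_iff_isRoot.2 hb
    have hq' : q' ≠ 0 := right_ne_zero_of_mul hq
    rw [mul_smul] at hh
    refine ih hq' (mem_reesModel_of_sub_smul_mem b hh) ?_
    rw [Polynomial.natDegree_mul (Polynomial.X_sub_C_ne_zero b) hq',
      Polynomial.natDegree_X_sub_C] at hn
    omega

/-- The codimension of the fibre in its normalization does not depend on the fibre. -/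
theorem exists_finrank_eq [IsAlgClosed k] {N : ℕ} (hA : IsPinched N A) : ∃ δ : ℕ, ∀ b : k,
    Module.finrank k ((Fin s → k[X]) ⧸ Subalgebra.toSubmodule (reesFibre A w b)) = δ := by
  let P : Submodule k[X] (Fin s → k[X][X]) := Subalgebra.toSubmodule (reesModel A w)
  have hfin : Module.Finite k[X] ((Fin s → k[X][X]) ⧸ P) :=
    (isPinched_reesModel (w := w) hA).finite_quotient
  have htf : Module.IsTorsionFree k[X] ((Fin s → k[X][X]) ⧸ P) := by
    refine Module.IsTorsionFree.of_smul_eq_zero fun q x hqx => ?_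
    rw [or_iff_not_imp_left]
    intro hq
    obtain ⟨h, rfl⟩ := Submodule.mkQ_surjective _ x
    rw [← map_smul, Submodule.mkQ_apply, Submodule.Quotient.mk_eq_zero] at hqx
    rw [Submodule.mkQ_apply, Submodule.Quotient.mk_eq_zero]
    exact mem_reesModel_of_smul_mem hq hqx
  have hfree : Module.Free k[X] ((Fin s → k[X][X]) ⧸ P) := inferInstance
  let ι := Module.Free.ChooseBasisIndex k[X] ((Fin s → k[X][X]) ⧸ P)
  let e : ((Fin s → k[X][X]) ⧸ P) ≃ₗ[k[X]] (ι → k[X]) :=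
    (Module.Free.chooseBasis k[X] ((Fin s → k[X][X]) ⧸ P)).equivFun
  refine ⟨Fintype.card ι, fun b => ?_⟩
  let L₁ : (Fin s → k[X][X]) →ₗ[k] (ι → k) :=
    { toFun g := fun i => (e (P.mkQ g) i).eval b
      map_add' g h := by ext i; simp
      map_smul' c g := by
        ext i
        have : c • g = (Polynomial.C c : k[X]) • g := by
          ext : 3; simp
        simp [this] }
  let L₂ : (Fin s → k[X][X]) →ₗ[k]
      ((Fin s → k[X]) ⧸ Subalgebra.toSubmodule (reesFibre A w b)) :=
    (Subalgebra.toSubmodule (reesFibre A w b)).mkQ ∘ₗ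
      { toFun := specialize k s b
        map_add' := map_add _
        map_smul' c g := by
          ext i m
          simp [specialize_apply] }
  have hL₁ : Function.Surjective L₁ := by
    intro v
    obtain ⟨g, hg⟩ := Submodule.mkQ_surjective P (e.symm fun i => Polynomial.C (v i))
    refine ⟨g, ?_⟩
    ext i
    change (e (P.mkQ g) i).eval b = v i
    rw [hg]
    simp
  have hL₂ : Function.Surjective L₂ := by
    refine (Submodule.mkQ_surjective _).comp fun f => ?_
    exact ⟨_, specialize_map_C b f⟩
  -- Both kernels consist of the sums of an element of the model and a multiple of `t - b`: `L₁`
  -- reduces the free quotient modulo `t - b`, and `L₂` specializes before dividing by the fibre.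
  have hker : LinearMap.ker L₁ = LinearMap.ker L₂ := by
    ext g
    have h1 : g ∈ LinearMap.ker L₁ ↔ ∀ i, (e (P.mkQ g) i).eval b = 0 := by
      rw [LinearMap.mem_ker, funext_iff]; rfl
    have h2 : g ∈ LinearMap.ker L₂ ↔ specialize k s b g ∈ reesFibre A w b := by
      rw [LinearMap.mem_ker, LinearMap.comp_apply, Submodule.mkQ_apply,
        Submodule.Quotient.mk_eq_zero]
      rfl
    rw [h1, h2]
    have hX (h : Fin s → k[X][X]) :
        specialize k s b ((Polynomial.X - Polynomial.C b) • h) = 0 := by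
      rw [Algebra.smul_def, map_mul, specialize_algebraMap]
      simp
    constructor
    · intro hg
      choose v hv using fun i => Polynomial.dvd_iff_isRoot.2 (hg i)
      obtain ⟨h, hh⟩ := Submodule.mkQ_surjective P (e.symm v)
      have heq : P.mkQ g = P.mkQ ((Polynomial.X - Polynomial.C b) • h) := by
        apply e.injective
        rw [map_smul, map_smul, hh, LinearEquiv.apply_symm_apply]
        ext1 i
        rw [hv i, Pi.smul_apply, smul_eq_mul]
      have hmem : g - (Polynomial.X - Polynomial.C b) • h ∈ reesModel A w :=
        (Submodule.Quotient.eq P).1 heq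
      refine ⟨_, hmem, ?_⟩
      rw [map_sub, hX, sub_zero]
    · rintro ⟨g', hg', hgg'⟩ i
      obtain ⟨h, hh⟩ := exists_eq_smul_of_specialize_eq_zero (b := b) (g := g - g') (by
        rw [map_sub, hgg', sub_self])
      have h0 : P.mkQ g' = 0 := (Submodule.Quotient.mk_eq_zero P).2 hg'
      have : P.mkQ g = (Polynomial.X - Polynomial.C b) • P.mkQ h := by
        rw [← map_smul, ← hh, map_sub, h0, sub_zero]
      rw [this, map_smul]
      simp
  let E := ((L₁.quotKerEquivOfSurjective hL₁).symm.trans (Submodule.quotEquivOfEq _ _ hker)).trans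
    (L₂.quotKerEquivOfSurjective hL₂)
  rw [← E.finrank_eq, Module.finrank_fintype_fun_eq_card]

end Fibre

end MonomialDegeneration

/-! ### Translation to schemes: local rings, curves, smoothness -/

namespace MonomialDegeneration

universe u

/-- A commutative square of rings with surjective `g` and `inl` is a pushout if the kernel of `inl`
is generated by the image of the kernel of `g`. -/
theorem isPushout_of_surjective {P Q K D : Type u} [CommRing P] [CommRing Q] [CommRing K]
    [CommRing D] (f : P →+* Q) (g : P →+* K) (inl : Q →+* D) (inr : K →+* D)
    (hcomm : inl.comp f = inr.comp g) (hg : Function.Surjective g)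
    (hinl : Function.Surjective inl) (hker : RingHom.ker inl ≤ (RingHom.ker g).map f) :
    IsPushout (CommRingCat.ofHom f) (CommRingCat.ofHom g) (CommRingCat.ofHom inl)
      (CommRingCat.ofHom inr) := by
  refine ⟨⟨by rw [← CommRingCat.ofHom_comp, ← CommRingCat.ofHom_comp, hcomm]⟩, ⟨?_⟩⟩
  refine PushoutCocone.IsColimit.mk _
    (fun c => CommRingCat.ofHom (inl.liftOfSurjective hinl ⟨c.inl.hom, ?_⟩)) ?_ ?_ ?_
  · refine hker.trans (Ideal.map_le_iff_le_comap.2 fun x hx => ?_)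
    have h := congrArg (fun φ => φ.hom x) c.condition
    have h' : c.inl.hom (f x) = c.inr.hom (g x) := h
    rw [Ideal.mem_comap, RingHom.mem_ker, h', (RingHom.mem_ker).1 hx, map_zero]
  · intro c
    ext x
    exact RingHom.liftOfRightInverse_comp_apply inl _ (Function.rightInverse_surjInv hinl) _ x
  · intro c
    ext x
    obtain ⟨y, rfl⟩ := hg x
    have h := congrArg (fun φ => φ.hom y) c.condition
    have h' : c.inl.hom (f y) = c.inr.hom (g y) := h
    have h2 : inr (g y) = inl (f y) := (congrArg (fun φ : P →+* D => φ y) hcomm).symm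
    change inl.liftOfSurjective hinl _ (inr (g y)) = c.inr.hom (g y)
    rw [h2, ← h']
    exact RingHom.liftOfRightInverse_comp_apply inl _ (Function.rightInverse_surjInv hinl) _ (f y)
  · intro c m h1 _
    ext x
    obtain ⟨y, rfl⟩ := hinl x
    have h := congrArg (fun φ => φ.hom y) h1
    refine (show m.hom (inl y) = c.inl.hom y from h).trans ?_
    exact (RingHom.liftOfRightInverse_comp_apply inl _ (Function.rightInverse_surjInv hinl)
      ⟨c.inl.hom, _⟩ y).symm

section Branches

variable {k : Type u} [Field k] {s N : ℕ} {B : Subalgebra k (Fin s → k[X])}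

theorem IsPinched.schemeHasBranchesAndDelta (hB : IsPinched N B) (i : Fin s) {X : Scheme.{u}}
    (f : X ⟶ Spec (CommRingCat.of k)) (e : X ≅ Spec (CommRingCat.of B))
    (he : e.hom ≫ specStructure k B = f) (x : X)
    (hx : (e.hom x).asIdeal = RingHom.ker (IsPinched.constCoeff B i)) :
    SchemeHasBranchesAndDelta f x s
      (Module.finrank k ((Fin s → k[X]) ⧸ Subalgebra.toSubmodule B)) := by
  let y : PrimeSpectrum B := e.hom x
  let O := X.presheaf.stalk x
  -- Transporting the stalk along `e` makes `O` a localization of `B` at the ideal of the pinched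
  -- point, compatibly with `k`.
  let φ : CommRingCat.of B ⟶ O := (Scheme.ΓSpecIso (CommRingCat.of B)).inv ≫
    (Spec (CommRingCat.of B)).presheaf.germ ⊤ (e.hom x) trivial ≫ e.hom.stalkMap x
  let : Algebra k O := (stalkStructure f x).toAlgebra
  let : Algebra B O := φ.hom.toAlgebra
  have : IsScalarTower k B O := by
    refine IsScalarTower.of_algebraMap_eq' ?_
    have : (Scheme.ΓSpecIso (CommRingCat.of k)).inv ≫ f.appTop ≫ X.presheaf.germ ⊤ x trivial =
        CommRingCat.ofHom (algebraMap k B) ≫ φ := by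
      subst he
      simp only [φ, specStructure]
      rw [Scheme.ΓSpecIso_inv_naturality_assoc, Scheme.Hom.comp_appTop, Category.assoc]
      congr 2
      exact (Scheme.Hom.germ_stalkMap e.hom ⊤ x (Set.mem_univ _)).symm
    exact congrArg CommRingCat.Hom.hom this
  let st := (Spec (CommRingCat.of B)).presheaf.stalk (e.hom x)
  let : Algebra B st := StructureSheaf.stalkAlgebra B y
  have : IsLocalization.AtPrime st y.asIdeal := StructureSheaf.IsLocalization.to_stalk B y
  let E : st ≃ₐ[B] O := AlgEquiv.ofRingEquiv
    (f := (asIso (e.hom.stalkMap x)).commRingCatIsoToRingEquiv) fun b => rfl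
  have : IsLocalization.AtPrime O y.asIdeal :=
    IsLocalization.isLocalization_of_algEquiv y.asIdeal.primeCompl E
  exact hB.hasBranchesAndDelta_of_isLocalization i (O := O) y.asIdeal hx

theorem IsPinched.isConnectedAffineCurve (hB : IsPinched N B) (i : Fin s) {X : Scheme.{u}}
    (f : X ⟶ Spec (CommRingCat.of k)) (e : X ≅ Spec (CommRingCat.of B))
    (he : e.hom ≫ specStructure k B = f) : IsConnectedAffineCurve f where
  isAffine := .of_isIso e.hom
  finiteType := by
    have : LocallyOfFiniteType (specStructure k B) := by
      rw [specStructure, HasRingHomProperty.Spec_iff (P := @LocallyOfFiniteType)]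
      exact RingHom.finiteType_algebraMap.2 hB.finiteType
    rw [← he]
    infer_instance
  isReduced := by
    have := IsPinched.isReduced B
    exact isReduced_of_isOpenImmersion e.hom
  connected := by
    have : ConnectedSpace (Spec (CommRingCat.of B)) := hB.connectedSpace i
    exact e.hom.homeomorph.connectedSpace_iff.2 this
  dim_eq_one Z hZ := by
    let h := e.hom.homeomorph
    have hZ' : h '' Z ∈ irreducibleComponents (PrimeSpectrum B) :=
      image_mem_irreducibleComponents_of_isPreirreducible_fiber h h.continuous h.isOpenMap
        (fun x => (Set.subsingleton_singleton.preimage h.injective).isPreirreducible)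
        h.surjective hZ
    rw [← hB.topologicalKrullDim_eq_one _ hZ']
    exact IsHomeomorph.topologicalKrullDim_eq _ (h.image Z).isHomeomorph

end Branches

section Smooth

variable {K : Type u} [CommRing K] {s N : ℕ} {B : Subalgebra K (Fin s → K[X])}

theorem smooth_laurent (K : Type u) [CommRing K] :
    ((algebraMap K[X] K[T;T⁻¹]).comp (algebraMap K K[X])).Smooth := by
  refine RingHom.Smooth.comp ?_ ?_
  · rw [RingHom.smooth_algebraMap]
    exact { }
  · exact RingHom.Smooth.holdsForLocalizationAway _ (Polynomial.X : K[X])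

/-- Away from the pinched point, a family of pinched lines is smooth. -/
theorem IsPinched.exists_smooth (hB : IsPinched N B) (i₀ : Fin s) :
    ∃ U : (Spec (CommRingCat.of B)).Opens, (U : Set (Spec (CommRingCat.of B))) =
      (Set.range (Spec.map (CommRingCat.ofHom (IsPinched.constCoeff B i₀).toRingHom)))ᶜ ∧
      Smooth (U.ι ≫ Spec.map (CommRingCat.ofHom (algebraMap K B))) := by
  let σ := Spec.map (CommRingCat.ofHom (IsPinched.constCoeff B i₀).toRingHom)
  have hσ : Set.range σ = PrimeSpectrum.zeroLocus
      (RingHom.ker (IsPinched.constCoeff B i₀).toRingHom : Set B) :=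
    range_comap_of_surjective _ _ (IsPinched.constCoeff_surjective i₀)
  let U : (Spec (CommRingCat.of B)).Opens := ⟨(Set.range σ)ᶜ, by
    rw [isOpen_compl_iff, hσ]; exact PrimeSpectrum.isClosed_zeroLocus _⟩
  let φ (i : Fin s) : B →+* K[T;T⁻¹] :=
    (algebraMap K[X] K[T;T⁻¹]).comp (IsPinched.coord B i).toRingHom
  let j (i : Fin s) : Spec (CommRingCat.of K[T;T⁻¹]) ⟶ Spec (CommRingCat.of B) :=
    Spec.map (CommRingCat.ofHom (φ i))
  have hj (i : Fin s) : IsOpenImmersion (j i) := by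
    let : Algebra B K[T;T⁻¹] := (φ i).toAlgebra
    have : IsLocalization.Away (hB.branchCoord i) K[T;T⁻¹] := hB.isLocalization_away i
    exact IsOpenImmersion.of_isLocalization (hB.branchCoord i)
  have hjr (i : Fin s) : Set.range (j i) =
      ((PrimeSpectrum.basicOpen (hB.branchCoord i) : TopologicalSpace.Opens (PrimeSpectrum B)) :
        Set (PrimeSpectrum B)) := by
    let : Algebra B K[T;T⁻¹] := (φ i).toAlgebra
    have : IsLocalization.Away (hB.branchCoord i) K[T;T⁻¹] := hB.isLocalization_away i
    exact PrimeSpectrum.localization_away_comap_range K[T;T⁻¹] (hB.branchCoord i)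
  have hle (i : Fin s) : Set.range (j i) ⊆ Set.range U.ι := by
    rw [hjr, Scheme.Opens.range_ι]
    intro x hx hxσ
    rw [hσ] at hxσ
    exact hx (hxσ (hB.branchCoord_constCoeff i₀ i))
  refine ⟨U, rfl, ?_⟩
  -- A prime containing every `branchCoord i` lies on the section, so the branch charts cover its
  -- complement.
  let 𝒰 : Scheme.OpenCover.{0} U := Scheme.Cover.mkOfCovers (Fin s) (fun _ => _)
    (fun i => IsOpenImmersion.lift U.ι (j i) (hle i)) (by
      intro x
      have hx : U.ι x ∉ Set.range σ := x.2
      have : ∃ i, hB.branchCoord i ∉ (U.ι x).asIdeal := by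
        by_contra! h
        apply hx
        rw [hσ]
        exact fun f hf => hB.mem_of_branchCoord_mem (U.ι x).isPrime h hf
      obtain ⟨i, hi⟩ := this
      have hmem : U.ι x ∈ Set.range (j i) := by rw [hjr]; exact hi
      obtain ⟨y, hy⟩ := hmem
      refine ⟨i, y, U.ι.injective ?_⟩
      rw [← Scheme.Hom.comp_apply, IsOpenImmersion.lift_fac, hy])
    (fun i => inferInstance)
  have := HasRingHomProperty.instIsZariskiLocalAtSource (P := @Smooth.{u})
  refine IsZariskiLocalAtSource.of_openCover (P := @Smooth) 𝒰 fun i => ?_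
  change Smooth (IsOpenImmersion.lift U.ι (j i) (hle i) ≫ U.ι ≫ _)
  rw [← Category.assoc, IsOpenImmersion.lift_fac, ← Spec.map_comp,
    HasRingHomProperty.Spec_iff (P := @Smooth)]
  have : (CommRingCat.ofHom (algebraMap K B) ≫ CommRingCat.ofHom (φ i)).hom =
      (algebraMap K[X] K[T;T⁻¹]).comp (algebraMap K K[X]) := by
    ext c
    rfl
  rw [this]
  exact smooth_laurent K

end Smooth

end MonomialDegeneration

/-! ### The Rees family, its fibres and its section -/

namespace MonomialDegeneration

universe u

variable {k : Type u} [Field k] {s N : ℕ} {A : Subalgebra k (Fin s → k[X])} {w : Fin s → ℕ}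

variable (A w) in
/-- The morphism to the affine line from the spectrum of `reesModel A w`. -/
noncomputable abbrev modelFamily : Spec (CommRingCat.of (reesModel A w)) ⟶ affineLine k :=
  Spec.map (CommRingCat.ofHom (algebraMap k[X] (reesModel A w)))

theorem exists_reesTotal_iso (A : Subalgebra k (Fin s → k[X])) (w : Fin s → ℕ) :
    ∃ ε : reesTotal A w ≅ Spec (CommRingCat.of (reesModel A w)),
      ε.hom ≫ modelFamily A w = reesFamily A w := by
  obtain ⟨e, -, he⟩ := exists_reesEquiv A w
  have h : e.symm.toRingHom.comp (algebraMap k[X] (reesModel A w)) =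
      (reesParameter (weightFiltration A w)).toRingHom :=
    RingHom.ext fun q => (e.symm_apply_eq).2 (he q).symm
  refine ⟨⟨Spec.map (CommRingCat.ofHom e.symm.toRingHom),
    Spec.map (CommRingCat.ofHom e.toRingHom), ?_, ?_⟩, ?_⟩
  · rw [← Spec.map_comp, ← CommRingCat.ofHom_comp, RingEquiv.symm_toRingHom_comp_toRingHom, CommRingCat.ofHom_id,
      Spec.map_id]
  · rw [← Spec.map_comp, ← CommRingCat.ofHom_comp, RingEquiv.toRingHom_comp_symm_toRingHom, CommRingCat.ofHom_id,
      Spec.map_id]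
  · rw [← Spec.map_comp, ← CommRingCat.ofHom_comp, h]
    rfl

theorem isPullback_modelFamily (b : k) :
    IsPullback (Spec.map (CommRingCat.ofHom (toReesFibre A w b)))
      (specStructure k (reesFibre A w b)) (modelFamily A w) (linePoint k b) := by
  refine isPullback_SpecMap_of_isPushout _ _ _ _ (isPushout_of_surjective _ _ _ _ ?_ ?_ ?_ ?_)
  · exact RingHom.ext fun q => toReesFibre_algebraMap b q
  · exact fun c => ⟨Polynomial.C c, by simp⟩
  · exact toReesFibre_surjective b
  · rw [ker_toReesFibre, Ideal.span_singleton_le_iff_mem]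
    refine Ideal.mem_map_of_mem _ ?_
    simp [RingHom.mem_ker]

theorem exists_fibre_iso {𝒴 : Scheme.{u}} {π : 𝒴 ⟶ affineLine k}
    (ε : 𝒴 ≅ Spec (CommRingCat.of (reesModel A w))) (hε : ε.hom ≫ modelFamily A w = π) (b : k) :
    ∃ E : fibre π b ≅ Spec (CommRingCat.of (reesFibre A w b)),
      E.hom ≫ specStructure k (reesFibre A w b) = fibreStructure π b ∧
      E.inv ≫ pullback.fst π (linePoint k b) =
        Spec.map (CommRingCat.ofHom (toReesFibre A w b)) ≫ ε.inv := by
  have h : IsPullback (Spec.map (CommRingCat.ofHom (toReesFibre A w b)) ≫ ε.inv)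
      (specStructure k (reesFibre A w b)) π (linePoint k b) :=
    IsPullback.of_iso (isPullback_modelFamily (A := A) (w := w) b) (Iso.refl _) ε.symm (Iso.refl _)
      (Iso.refl _) (by simp) (by simp) (by simp [← hε]) (by simp)
  exact ⟨h.isoPullback.symm, by simp, by simp⟩

variable (A w) in
/-- The section of the Rees degeneration through the pinched points of the fibres. -/
noncomputable abbrev modelSection (i : Fin s) :
    affineLine k ⟶ Spec (CommRingCat.of (reesModel A w)) :=
  Spec.map (CommRingCat.ofHom (IsPinched.constCoeff (reesModel A w) i).toRingHom)

theorem modelSection_comp (i : Fin s) :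
    modelSection A w i ≫ modelFamily A w = 𝟙 (affineLine k) := by
  have h : (IsPinched.constCoeff (reesModel A w) i).toRingHom.comp
      (algebraMap k[X] (reesModel A w)) = RingHom.id _ :=
    RingHom.ext fun q => (IsPinched.constCoeff (reesModel A w) i).commutes q
  rw [← Spec.map_comp, ← CommRingCat.ofHom_comp, h, CommRingCat.ofHom_id, Spec.map_id]

theorem constCoeff_toReesFibre (b : k) (i : Fin s) (g : reesModel A w) :
    IsPinched.constCoeff (reesFibre A w b) i (toReesFibre A w b g) =
      (IsPinched.constCoeff (reesModel A w) i g).eval b := by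
  rw [IsPinched.constCoeff_apply, IsPinched.constCoeff_apply, toReesFibre_coe, specialize_apply,
    Polynomial.coeff_map]
  rfl

/-- Taking the value at the pinched point commutes with setting `t = b`, so the section meets the
fibre in its own pinched point. -/
theorem asIdeal_sectionAt {𝒴 : Scheme.{u}} {π : 𝒴 ⟶ affineLine k}
    (ε : 𝒴 ≅ Spec (CommRingCat.of (reesModel A w))) (i : Fin s)
    (hσ : (modelSection A w i ≫ ε.inv) ≫ π = 𝟙 _) {b : k}
    (E : fibre π b ≅ Spec (CommRingCat.of (reesFibre A w b)))
    (hE : E.hom ≫ specStructure k (reesFibre A w b) = fibreStructure π b)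
    (hE' : E.inv ≫ pullback.fst π (linePoint k b) =
      Spec.map (CommRingCat.ofHom (toReesFibre A w b)) ≫ ε.inv) :
    (E.hom (sectionAt π (modelSection A w i ≫ ε.inv) hσ b)).asIdeal =
      RingHom.ker (IsPinched.constCoeff (reesFibre A w b) i) := by
  have hpt : sectionPoint π (modelSection A w i ≫ ε.inv) hσ b ≫ E.hom =
      Spec.map (CommRingCat.ofHom (IsPinched.constCoeff (reesFibre A w b) i).toRingHom) := by
    rw [← Iso.eq_comp_inv]
    apply pullback.hom_ext
    · rw [sectionPoint, pullback.lift_fst, Category.assoc, hE', linePoint, ← Category.assoc,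
        ← Category.assoc, ← Spec.map_comp, ← Spec.map_comp, ← CommRingCat.ofHom_comp,
        ← CommRingCat.ofHom_comp]
      congr 3
      ext1 g
      exact (constCoeff_toReesFibre b i g).symm
    · rw [sectionPoint, pullback.lift_snd, Category.assoc]
      have : E.inv ≫ pullback.snd π (linePoint k b) = specStructure k (reesFibre A w b) := by
        rw [Iso.inv_comp_eq, hE]
      have h : (IsPinched.constCoeff (reesFibre A w b) i).toRingHom.comp
          (algebraMap k (reesFibre A w b)) = RingHom.id _ :=
        RingHom.ext fun c => (IsPinched.constCoeff (reesFibre A w b) i).commutes c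
      rw [this, specStructure, ← Spec.map_comp, ← CommRingCat.ofHom_comp, h, CommRingCat.ofHom_id,
        Spec.map_id]
  change ((sectionPoint π _ hσ b ≫ E.hom) (⊥ : PrimeSpectrum k)).asIdeal = _
  rw [hpt]
  exact (RingHom.ker_eq_comap_bot _).symm

theorem flat_subalgebra {R S : Type*} [CommRing R] [IsDedekindDomain R] [CommRing S] [Algebra R S]
    [Module.IsTorsionFree R S] (B : Subalgebra R S) : Module.Flat R B :=
  have : Module.IsTorsionFree R B := Subtype.val_injective.moduleIsTorsionFree _ fun _ _ => rfl
  inferInstance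

theorem flat_modelFamily : Flat (modelFamily A w) := by
  rw [Flat.SpecMap_iff]
  exact RingHom.flat_algebraMap_iff.2 (flat_subalgebra (reesModel A w))

theorem locallyOfFinitePresentation_modelFamily (hA : IsPinched N A) :
    LocallyOfFinitePresentation (modelFamily A w) := by
  rw [HasRingHomProperty.Spec_iff (P := @LocallyOfFinitePresentation)]
  have := (isPinched_reesModel (w := w) hA).finiteType
  exact RingHom.finitePresentation_algebraMap.2 (Algebra.FinitePresentation.of_finiteType.1 this)

theorem isIsoOver_of_algEquiv {X : Scheme.{u}} {f : X ⟶ Spec (CommRingCat.of k)}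
    {B C : Type u} [CommRing B] [CommRing C] [Algebra k B] [Algebra k C]
    (h : IsIsoOver f (specStructure k B)) (e : C ≃ₐ[k] B) : IsIsoOver f (specStructure k C) := by
  obtain ⟨E, hE⟩ := h
  refine ⟨E ≪≫ Scheme.Spec.mapIso e.toRingEquiv.toCommRingCatIso.op, ?_⟩
  rw [Iso.trans_hom, Category.assoc, ← hE]
  congr 1
  change Spec.map (CommRingCat.ofHom e.toRingEquiv.toRingHom) ≫ Spec.map _ = Spec.map _
  rw [← Spec.map_comp, ← CommRingCat.ofHom_comp]
  congr 2
  ext1 c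
  exact e.commutes c

end MonomialDegeneration

open MonomialDegeneration in
theorem theorem3p4 {k : Type*} [Field k] [IsAlgClosed k] {s : ℕ}
    (A : Subalgebra k (Fin s → k[X])) (𝔪 : Ideal A) (hA : IsRationalCurve A 𝔪) :
    ∃ w : Fin s → ℕ, (∀ i, 0 < w i) ∧
      Flat (reesFamily A w) ∧
      LocallyOfFinitePresentation (reesFamily A w) ∧
      (∀ b : k, IsConnectedAffineCurve (fibreStructure (reesFamily A w) b)) ∧
      (∃ (σ : affineLine k ⟶ reesTotal A w) (hσ : σ ≫ reesFamily A w = 𝟙 (affineLine k)),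
        (∃ U : (reesTotal A w).Opens, (U : Set (reesTotal A w)) = (Set.range σ)ᶜ ∧
          Smooth (U.ι ≫ reesFamily A w)) ∧
        (∃ δ : ℕ, ∀ b : k, SchemeHasBranchesAndDelta (fibreStructure (reesFamily A w) b)
          (sectionAt (reesFamily A w) σ hσ b) s δ)) ∧
      (∀ b : k, b ≠ 0 → IsIsoOver (fibreStructure (reesFamily A w) b) (specStructure k A)) ∧
      (∃ A₀ : Subalgebra k (Fin s → k[X]), IsMonomialSubring A₀ ∧
        IsNormalizationMap A₀.val.toRingHom ∧
        IsIsoOver (fibreStructure (reesFamily A w) 0) (specStructure k A₀)) := by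
  obtain ⟨N, hN⟩ := hA.exists_isPinched
  let i₀ : Fin s := ⟨0, hA.pos⟩
  -- Any weights separating the nonconstant monomials of degree below `N` on different branches
  -- would do; powers of `N + 1` achieve this.
  let w : Fin s → ℕ := fun i => (N + 1) ^ (i : ℕ)
  have hpos (i : Fin s) : 0 < w i := by positivity
  have hw (i j : Fin s) (hij : i ≠ j) (l m : ℕ) (hm : 0 < m) (hmN : m < N) (hl : l < N) :
      w i * m ≠ w j * l := pow_mul_ne_pow_mul (fun h => hij (Fin.ext h)) hm hmN hl
  obtain ⟨ε, hε⟩ := exists_reesTotal_iso A w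
  choose E hE hE' using exists_fibre_iso ε hε
  have hflat := flat_modelFamily (A := A) (w := w)
  have hfp := locallyOfFinitePresentation_modelFamily (w := w) hN
  have hfib (b : k) := isPinched_reesFibre (w := w) hN b
  have hσ : (modelSection A w i₀ ≫ ε.inv) ≫ reesFamily A w = 𝟙 (affineLine k) := by
    rw [← hε, Category.assoc, Iso.inv_hom_id_assoc, modelSection_comp]
  refine ⟨w, hpos, ?_, ?_, fun b => (hfib b).isConnectedAffineCurve i₀ _ (E b) (hE b),
    ⟨_, hσ, ?_, ?_⟩, fun b hb => ?_, ?_⟩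
  · rw [← hε]; infer_instance
  · rw [← hε]; infer_instance
  -- That the complement of the section is an open set also records that the section has closed
  -- image.
  · obtain ⟨U, hU, hsm⟩ := (isPinched_reesModel (w := w) hN).exists_smooth i₀
    refine ⟨ε.hom ⁻¹ᵁ U, ?_, ?_⟩
    · ext x
      have hx : x ∈ ε.hom ⁻¹ᵁ U ↔ ε.hom x ∉ Set.range (modelSection A w i₀) := by
        rw [← Set.mem_compl_iff, ← hU]
        rfl
      refine hx.trans (not_congr ?_)
      constructor
      · rintro ⟨y, hy⟩
        refine ⟨y, ?_⟩
        rw [Scheme.Hom.comp_apply, hy, ← Scheme.Hom.comp_apply, Iso.hom_inv_id]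
        rfl
      · rintro ⟨y, rfl⟩
        refine ⟨y, ?_⟩
        rw [← Scheme.Hom.comp_apply, Category.assoc, Iso.inv_hom_id, Category.comp_id]
    · rw [← hε, ← Category.assoc, ← morphismRestrict_ι, Category.assoc]
      infer_instance
  · obtain ⟨δ, hδ⟩ := exists_finrank_eq (w := w) hN
    refine ⟨δ, fun b => ?_⟩
    rw [← hδ b]
    exact (hfib b).schemeHasBranchesAndDelta i₀ _ (E b) (hE b) _
      (asIdeal_sectionAt ε i₀ hσ (E b) (hE b) (hE' b))
  · obtain ⟨e⟩ := exists_algEquiv_reesFibre (A := A) (w := w) hb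
    exact isIsoOver_of_algEquiv ⟨E b, hE b⟩ e
  · exact ⟨reesFibre A w 0, isMonomialSubring_reesFibre_zero hN i₀ hw hpos,
      (hfib 0).isNormalizationMap, E 0, hE 0⟩
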